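/- Let $\mathcal H$ and $\mathcal K$ be complex Hilbert spaces, and let $b\mapsto b^t$ be the transposition of $\mathcal B(\mathcal K)$ with respect to an orthonormal basis of $\mathcal K$. A linear functional on $\mathcal B(\mathcal H)$ is called normal if it is ultraweakly (i.e. weak-$*$) continuous; $\mathcal B(\mathcal K)_*$ denotes the Banach space of normal functionals on $\mathcal B(\mathcal K)$, identified with the trace class operators $T$ on $\mathcal K$ by $b\mapsto \mathrm{Tr}(Tb)$. Let $\mathcal B[\mathcal B(\mathcal H),\mathcal B(\mathcal K)_*]$ be the space of bounded linear maps $\psi:\mathcal B(\mathcal H)\to\mathcal B(\mathcal K)_*$ that are normal (continuous from the ultraweak topology to the weak topology $\sigma(\mathcal B(\mathcal K)_*,\mathcal B(\mathcal K))$), with the operator norm. Let $\mathcal B(\mathcal H)\hat\otimes\mathcal B(\mathcal K)$ be the completion of the algebraic tensor product $\mathcal B(\mathcal H)\odot\mathcal B(\mathcal K)$ in the projective norm $\|x\|=\inf\{\sum_i\|a_i\|\|b_i\| : x=\sum_i a_i\otimes b_i\}$, and let $(\mathcal B(\mathcal H)\otimes\mathcal B(\mathcal K))_*$ denote the space of normal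 functionals on it, i.e. of the bounded linear functionals $\Psi$ on $\mathcal B(\mathcal H)\hat\otimes\mathcal B(\mathcal K)$ for which $\Psi(a\otimes b)$ is ultraweakly continuous in $a$ for each $b$ and in $b$ for each $a$, with the norm of $(\mathcal B(\mathcal H)\hat\otimes\mathcal B(\mathcal K))^*$. Call $\Psi$ positive on the injective cone if $\Psi(x)\ge0$ for each $x\in\mathcal B(\mathcal H)\odot\mathcal B(\mathcal K)$ that is a positive operator on $\mathcal H\otimes\mathcal K$. A map $\phi$ into the trace class operators is completely positive (CP) if $[a_{ij}]\ge0$ in $M_n(\mathcal B(\mathcal H))$ implies $[\phi(a_{ij})]\ge 0$ in $M_n(\mathcal B(\mathcal K))$ for all $n$, and completely co-positive if $a\mapsto\phi(a)^t$ is completely positive. (1) There is an isometric linear isomorphism $\psi\mapsto\Psi$ of $\mathcal B[\mathcal B(\mathcal H),\mathcal B(\mathcal K)_*]$ onto $(\mathcal B(\mathcal H)\otimes\mathcal B(\mathcal K))_*$ with $$\Psi\Big(\sum_i a_i\otimes b_i\Big)=\sum_i\mathrm{Tr}_{\mathcal K}\,\psi(a_i)b_i^t ,\qquad a_i\in\mathcal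 B(\mathcal H),\ b_i\in\mathcal B(\mathcal K),$$ for all finite sums. Furthermore, $\Psi$ is positive on the injective cone if and only if $\psi$ is completely positive. (2) There is an isometric linear isomorphism $\phi\mapsto\Phi$ between the same spaces with $$\Phi\Big(\sum_i a_i\otimes b_i\Big)=\sum_i\mathrm{Tr}_{\mathcal K}\,\phi(a_i)b_i .$$ Furthermore, $\Phi$ is positive on the injective cone if and only if $\phi$ is completely co-positive. (3) The space $(\mathcal B(\mathcal H)\otimes\mathcal B(\mathcal K))_*$ contains the restrictions to $\mathcal B(\mathcal H)\odot\mathcal B(\mathcal K)$ of all normal functionals on $\mathcal B(\mathcal H\otimes\mathcal K)$, and an element of it is positive on the injective cone if and only if it is, on $\mathcal B(\mathcal H)\odot\mathcal B(\mathcal K)$, the restriction of a positive normal functional on $\mathcal B(\mathcal H\otimes\mathcal K)$. -/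

import Mathlib

open scoped TensorProduct ComplexOrder InnerProductSpace Topology

noncomputable section

set_option linter.unusedSectionVars false

namespace EntanglementMaps

/-! ### Normal functionals and the predual of `B(H)` -/

section Predual

variable (H : Type*) [NormedAddCommGroup H] [InnerProductSpace ℂ H] [CompleteSpace H]

/-- The ultraweak (`σ`-weak) topology on `B(H)`: the weak topology given by the functionals
`x ↦ ∑ₙ ⟪uₙ, x vₙ⟫` with `∑ ‖uₙ‖² < ∞` and `∑ ‖vₙ‖² < ∞`, that is, the weak-* topology of `B(H)`
as the dual of the trace class operators. -/
@[reducible]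
def ultraweak : TopologicalSpace (H →L[ℂ] H) :=
  ⨅ p : {p : (ℕ → H) × (ℕ → H) //
      (Summable fun n => ‖p.1 n‖ ^ 2) ∧ Summable fun n => ‖p.2 n‖ ^ 2},
    TopologicalSpace.induced (fun x : H →L[ℂ] H => ∑' n, ⟪p.1.1 n, x (p.1.2 n)⟫_ℂ) inferInstance

/-- The predual `B(H)_*`: the normal (ultraweakly continuous) functionals on `B(H)`, with the norm
of the dual of `B(H)`. -/
def Predual : Submodule ℂ ((H →L[ℂ] H) →L[ℂ] ℂ) where
  carrier := {f | Continuous[ultraweak H, inferInstance] fun x => f x}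
  add_mem' {f g} hf hg := by
    let _ := ultraweak H
    exact Continuous.add hf hg
  zero_mem' := by
    let _ := ultraweak H
    exact (continuous_const : Continuous fun _ : H →L[ℂ] H => (0 : ℂ))
  smul_mem' c f hf := by
    let _ := ultraweak H
    exact Continuous.const_smul hf c

instance : NormedAddCommGroup (Predual H) := Submodule.normedAddCommGroup _

instance : NormedSpace ℂ (Predual H) := Submodule.normedSpace _

instance : IsTopologicalAddGroup (Predual H) := SeminormedAddCommGroup.toIsTopologicalAddGroup

instance : ContinuousAdd (Predual H) := IsTopologicalAddGroup.toContinuousAdd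

/-- The weak topology `σ(B(H)_*, B(H))` on the predual. -/
@[reducible]
def predualWeak : TopologicalSpace (Predual H) :=
  ⨅ b : H →L[ℂ] H,
    TopologicalSpace.induced (fun f : Predual H => (f : (H →L[ℂ] H) →L[ℂ] ℂ) b) inferInstance

end Predual

section Density

variable {H : Type*} [NormedAddCommGroup H] [InnerProductSpace ℂ H] [CompleteSpace H]

/-- The operator `T` that represents a functional `f` on `B(H)`: `⟪w, T v⟫ = f(|v⟩⟨w|)`. For
`f` in the predual this is the trace class operator with `f(b) = Tr (T b)`. -/
def density (f : (H →L[ℂ] H) →L[ℂ] ℂ) : H →L[ℂ] H :=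
  ContinuousLinearMap.adjoint (InnerProductSpace.continuousLinearMapOfBilin
    (f.postcomp H ∘SL (InnerProductSpace.rankOne ℂ : H →L[ℂ] H →L⋆[ℂ] H →L[ℂ] H).flip))

theorem inner_density (f : (H →L[ℂ] H) →L[ℂ] ℂ) (v w : H) :
    ⟪w, density f v⟫_ℂ = f (InnerProductSpace.rankOne ℂ v w) := by
  simp [density, ContinuousLinearMap.adjoint_inner_right]

/-- `T` has trace `z`: the diagonal of `T` in every orthonormal basis is summable, with sum `z`. -/
def HasTrace (T : H →L[ℂ] H) (z : ℂ) : Prop :=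
  ∀ (s : Set H) (f : HilbertBasis s ℂ H), HasSum (fun i => ⟪f i, T (f i)⟫_ℂ) z

/-- Complex conjugation with respect to an orthonormal basis:
`∑ i, c i • e i ↦ ∑ i, conj (c i) • e i`. -/
def conjugation {ι : Type*} (e : HilbertBasis ι ℂ H) : H →L⋆[ℂ] H :=
  (e.repr.symm.toContinuousLinearEquiv : lp (fun _ : ι => ℂ) 2 →L[ℂ] H) ∘SL
    (((starₗᵢ ℂ : lp (fun _ : ι => ℂ) 2 ≃ₗᵢ⋆[ℂ] lp (fun _ : ι => ℂ) 2).toContinuousLinearEquiv :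
      lp (fun _ : ι => ℂ) 2 →L⋆[ℂ] lp (fun _ : ι => ℂ) 2) ∘SL (e.repr.toContinuousLinearEquiv : H →L[ℂ] lp (fun _ : ι => ℂ) 2))

theorem inner_conjugation {ι : Type*} (e : HilbertBasis ι ℂ H) (x : H) (i : ι) :
    ⟪e i, conjugation e x⟫_ℂ = star ⟪e i, x⟫_ℂ := by
  simp [conjugation, ← HilbertBasis.repr_apply_apply, lp.star_apply]

/-- The transpose `bᵗ = J b* J` of `b` with respect to an orthonormal basis. -/
def transpose {ι : Type*} (e : HilbertBasis ι ℂ H) (b : H →L[ℂ] H) : H →L[ℂ] H :=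
  conjugation e ∘SL (ContinuousLinearMap.adjoint b ∘SL conjugation e)

theorem conjugation_basis {ι : Type*} (e : HilbertBasis ι ℂ H) (i : ι) :
    conjugation e (e i) = e i := by
  classical
  apply e.repr.injective
  ext j
  rw [HilbertBasis.repr_apply_apply, HilbertBasis.repr_apply_apply, inner_conjugation,
    orthonormal_iff_ite.mp e.orthonormal]
  split_ifs <;> simp

/-- The matrix of `bᵗ` is the transpose of the matrix of `b`. -/
theorem inner_transpose {ι : Type*} (e : HilbertBasis ι ℂ H) (b : H →L[ℂ] H) (i j : ι) :
    ⟪e i, transpose e b (e j)⟫_ℂ = ⟪e j, b (e i)⟫_ℂ := by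
  simp only [transpose, ContinuousLinearMap.comp_apply, inner_conjugation, conjugation_basis,
    ContinuousLinearMap.adjoint_inner_right]
  exact inner_conj_symm _ _

end Density

/-! ### The algebraic tensor product `B(H) ⊙ B(K)` and its projective completion -/

section Projective

variable (H K : Type*) [NormedAddCommGroup H] [InnerProductSpace ℂ H] [CompleteSpace H]
  [NormedAddCommGroup K] [InnerProductSpace ℂ K] [CompleteSpace K]

/-- The algebraic tensor product `B(H) ⊙ B(K)`; it carries the projective norm below. -/
def AlgTensor : Type _ := (H →L[ℂ] H) ⊗[ℂ] (K →L[ℂ] K)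

instance : AddCommGroup (AlgTensor H K) :=
  inferInstanceAs (AddCommGroup ((H →L[ℂ] H) ⊗[ℂ] (K →L[ℂ] K)))

instance : Module ℂ (AlgTensor H K) :=
  inferInstanceAs (Module ℂ ((H →L[ℂ] H) ⊗[ℂ] (K →L[ℂ] K)))

variable {H K}

/-- The elementary tensor `a ⊗ b` in `B(H) ⊙ B(K)`. -/
def tmul (a : H →L[ℂ] H) (b : K →L[ℂ] K) : AlgTensor H K := a ⊗ₜ[ℂ] b

/-- The costs `∑ᵢ ‖aᵢ‖ ‖bᵢ‖` of the representations `x = ∑ᵢ aᵢ ⊗ bᵢ` (finite sums). -/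
def projCosts (x : AlgTensor H K) : Set ℝ :=
  {r | ∃ l : List ((H →L[ℂ] H) × (K →L[ℂ] K)),
    x = (l.map fun p => tmul p.1 p.2).sum ∧ r = (l.map fun p => ‖p.1‖ * ‖p.2‖).sum}

theorem projCosts_nonneg {x : AlgTensor H K} {r : ℝ} (hr : r ∈ projCosts x) : 0 ≤ r := by
  obtain ⟨l, -, rfl⟩ := hr
  refine List.sum_nonneg fun r hr => ?_
  obtain ⟨p, -, rfl⟩ := List.mem_map.mp hr
  positivity

theorem projCosts_bddBelow (x : AlgTensor H K) : BddBelow (projCosts x) :=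
  ⟨0, fun _ => projCosts_nonneg⟩

theorem projCosts_add {x y : AlgTensor H K} {r s : ℝ} (hr : r ∈ projCosts x)
    (hs : s ∈ projCosts y) : r + s ∈ projCosts (x + y) := by
  obtain ⟨l, rfl, rfl⟩ := hr
  obtain ⟨m, rfl, rfl⟩ := hs
  exact ⟨l ++ m, by simp, by simp⟩

theorem projCosts_smul {x : AlgTensor H K} {r : ℝ} (c : ℂ) (hr : r ∈ projCosts x) :
    ‖c‖ * r ∈ projCosts (c • x) := by
  obtain ⟨l, rfl, rfl⟩ := hr
  refine ⟨l.map fun p => (c • p.1, p.2), ?_, ?_⟩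
  · rw [List.smul_sum, List.map_map, List.map_map]
    rfl
  · rw [List.map_map, ← List.sum_map_mul_left]
    simp [Function.comp_def, norm_smul, mul_assoc]

theorem projCosts_nonempty (x : AlgTensor H K) : (projCosts x).Nonempty := by
  refine TensorProduct.induction_on (motive := fun x : AlgTensor H K => (projCosts x).Nonempty)
    x ⟨0, [], rfl, rfl⟩ (fun a b => ⟨‖a‖ * ‖b‖, [(a, b)], ?_, by simp⟩) ?_
  · rw [List.map_singleton, List.sum_singleton]
    rfl
  · rintro x y ⟨r, hr⟩ ⟨s, hs⟩
    exact ⟨r + s, projCosts_add hr hs⟩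

/-- The projective norm `inf {∑ᵢ ‖aᵢ‖ ‖bᵢ‖ : x = ∑ᵢ aᵢ ⊗ bᵢ}`. -/
instance : Norm (AlgTensor H K) := ⟨fun x => sInf (projCosts x)⟩

theorem projNorm_smul_le (c : ℂ) (x : AlgTensor H K) : ‖c • x‖ ≤ ‖c‖ * ‖x‖ := by
  change sInf (projCosts (c • x)) ≤ ‖c‖ * sInf (projCosts x)
  rw [← smul_eq_mul, ← Real.sInf_smul_of_nonneg (norm_nonneg c)]
  refine le_csInf (projCosts_nonempty x).smul_set ?_
  rintro _ ⟨r, hr, rfl⟩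
  exact csInf_le (projCosts_bddBelow _) (projCosts_smul c hr)

theorem projNorm_add_le (x y : AlgTensor H K) : ‖x + y‖ ≤ ‖x‖ + ‖y‖ := by
  change sInf (projCosts (x + y)) ≤ sInf (projCosts x) + sInf (projCosts y)
  rw [← csInf_add (projCosts_nonempty x) (projCosts_bddBelow x) (projCosts_nonempty y)
    (projCosts_bddBelow y)]
  refine le_csInf ((projCosts_nonempty x).add (projCosts_nonempty y)) ?_
  rintro _ ⟨r, hr, s, hs, rfl⟩
  exact csInf_le (projCosts_bddBelow _) (projCosts_add hr hs)

theorem projNorm_zero : ‖(0 : AlgTensor H K)‖ = 0 :=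
  le_antisymm (csInf_le (projCosts_bddBelow _) ⟨[], by simp, by simp⟩)
    (le_csInf (projCosts_nonempty _) fun _ => projCosts_nonneg)

/-- The projective norm as a seminorm. -/
def projSeminorm : Seminorm ℂ (AlgTensor H K) :=
  Seminorm.ofSMulLE norm projNorm_zero projNorm_add_le projNorm_smul_le

instance : SeminormedAddCommGroup (AlgTensor H K) :=
  AddGroupSeminorm.toSeminormedAddCommGroup (projSeminorm (H := H) (K := K)).toAddGroupSeminorm

instance : NormedSpace ℂ (AlgTensor H K) := ⟨projNorm_smul_le⟩

variable (H K)

/-- The projective tensor product: the completion of `B(H) ⊙ B(K)` in the projective norm. -/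
abbrev ProjTensor : Type _ := UniformSpace.Completion (AlgTensor H K)

/-- The normal functionals on the projective tensor product of `B(H)` and `B(K)`: the bounded
functionals `Ψ` such that `Ψ(a ⊗ b)` is ultraweakly continuous in `a` and in `b`. The norm is that
of the dual of the projective tensor product. -/
def NormalFunctional : Submodule ℂ (ProjTensor H K →L[ℂ] ℂ) where
  carrier := {Ψ |
    (∀ b : K →L[ℂ] K, Continuous[ultraweak H, inferInstance]
      fun a : H →L[ℂ] H => Ψ (tmul a b : AlgTensor H K)) ∧
    (∀ a : H →L[ℂ] H, Continuous[ultraweak K, inferInstance]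
      fun b : K →L[ℂ] K => Ψ (tmul a b : AlgTensor H K))}
  add_mem' {f g} hf hg := by
    refine ⟨fun b => ?_, fun a => ?_⟩
    · let _ := ultraweak H
      exact Continuous.add (hf.1 b) (hg.1 b)
    · let _ := ultraweak K
      exact Continuous.add (hf.2 a) (hg.2 a)
  zero_mem' := by
    refine ⟨fun b => ?_, fun a => ?_⟩
    · let _ := ultraweak H
      exact (continuous_const : Continuous fun _ : H →L[ℂ] H => (0 : ℂ))
    · let _ := ultraweak K
      exact (continuous_const : Continuous fun _ : K →L[ℂ] K => (0 : ℂ))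
  smul_mem' c f hf := by
    refine ⟨fun b => ?_, fun a => ?_⟩
    · let _ := ultraweak H
      exact Continuous.const_smul (hf.1 b) c
    · let _ := ultraweak K
      exact Continuous.const_smul (hf.2 a) c

/-- The bounded normal maps `B(H) → B(K)_*`: continuous from the ultraweak topology of `B(H)` to
the weak topology of the predual. The norm is the operator norm. -/
def NormalMap : Submodule ℂ ((H →L[ℂ] H) →L[ℂ] Predual K) where
  carrier := {ψ | Continuous[ultraweak H, predualWeak K] fun a => ψ a}
  add_mem' {f g} hf hg := by
    let _ := ultraweak H
    refine continuous_iInf_rng.2 fun b => continuous_induced_rng.2 ?_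
    exact Continuous.add (continuous_induced_rng.1 (continuous_iInf_rng.1 hf b))
      (continuous_induced_rng.1 (continuous_iInf_rng.1 hg b))
  zero_mem' := by
    let _ := ultraweak H
    let _ := predualWeak K
    exact (continuous_const : Continuous fun _ : H →L[ℂ] H => (0 : Predual K))
  smul_mem' c f hf := by
    let _ := ultraweak H
    refine continuous_iInf_rng.2 fun b => continuous_induced_rng.2 ?_
    exact Continuous.const_smul (continuous_induced_rng.1 (continuous_iInf_rng.1 hf b)) c

/-! ### Positivity -/

/-- The Hilbert space tensor product of `H` and `K`. -/
abbrev HilbertTensor : Type _ := UniformSpace.Completion (H ⊗[ℂ] K)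

/-- The action of `B(H) ⊙ B(K)` on the Hilbert space tensor product:
`(a ⊗ b)(ξ ⊗ η) = aξ ⊗ bη`. -/
def toOperator : AlgTensor H K →ₗ[ℂ] (HilbertTensor H K →L[ℂ] HilbertTensor H K) :=
  TensorProduct.lift (LinearMap.mk₂ ℂ
    (fun (a : H →L[ℂ] H) (b : K →L[ℂ] K) => (TensorProduct.mapL a b).completion)
    (fun _ _ _ => by
      apply ContinuousLinearMap.coeFn_injective
      refine UniformSpace.Completion.ext (ContinuousLinearMap.continuous _)
        (ContinuousLinearMap.continuous _) fun x => ?_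
      simp [TensorProduct.map_add_left, UniformSpace.Completion.coe_add])
    (fun _ _ _ => by
      apply ContinuousLinearMap.coeFn_injective
      refine UniformSpace.Completion.ext (ContinuousLinearMap.continuous _)
        (ContinuousLinearMap.continuous _) fun x => ?_
      simp [TensorProduct.map_smul_left])
    (fun _ _ _ => by
      apply ContinuousLinearMap.coeFn_injective
      refine UniformSpace.Completion.ext (ContinuousLinearMap.continuous _)
        (ContinuousLinearMap.continuous _) fun x => ?_
      simp [TensorProduct.map_add_right, UniformSpace.Completion.coe_add])
    (fun _ _ _ => by
      apply ContinuousLinearMap.coeFn_injective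
      refine UniformSpace.Completion.ext (ContinuousLinearMap.continuous _)
        (ContinuousLinearMap.continuous _) fun x => ?_
      simp [TensorProduct.map_smul_right]))

theorem toOperator_tmul (a : H →L[ℂ] H) (b : K →L[ℂ] K) (ξ : H) (η : K) :
    toOperator H K (tmul a b) ((ξ ⊗ₜ[ℂ] η : H ⊗[ℂ] K) : HilbertTensor H K) =
      ((a ξ ⊗ₜ[ℂ] b η : H ⊗[ℂ] K) : HilbertTensor H K) := by
  change (TensorProduct.mapL a b).completion _ = _
  simp

variable {H K}

/-- `Ψ` is positive on the injective cone `(B(H) ⊗ B(K))⁺`: it is nonnegative at every tensor that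
is a positive operator on the Hilbert space tensor product. -/
def PositiveOnInjectiveCone (Ψ : ProjTensor H K →L[ℂ] ℂ) : Prop :=
  ∀ x : AlgTensor H K, 0 ≤ toOperator H K x → 0 ≤ Ψ x

/-- Complete positivity: entrywise application maps positive elements of the C⋆-algebra
`M_n(B(H))` to positive elements of `M_n(B(K))`, for all `n`. -/
def IsCompletelyPositive (φ : (H →L[ℂ] H) → (K →L[ℂ] K)) : Prop :=
  ∀ (n : ℕ) (M : CStarMatrix (Fin n) (Fin n) (H →L[ℂ] H)), 0 ≤ M → 0 ≤ M.map φ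

/-- Complete co-positivity: the composition with the transposition is completely positive. -/
def IsCompletelyCopositive {ι : Type*} (e : HilbertBasis ι ℂ K)
    (φ : (H →L[ℂ] H) → (K →L[ℂ] K)) : Prop :=
  IsCompletelyPositive fun a => transpose e (φ a)

/-- A normal map `B(H) → B(K)_*` regarded as a map into the trace class operators on `K`. -/
def traceClassMap (ψ : NormalMap H K) (a : H →L[ℂ] H) : K →L[ℂ] K :=
  density ((ψ : (H →L[ℂ] H) →L[ℂ] Predual K) a : (K →L[ℂ] K) →L[ℂ] ℂ)

end Projective

end EntanglementMaps

end

noncomputable section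

set_option linter.unusedSectionVars false

open Filter InnerProductSpace

/-! A bounded bilinear form on `B(H) × B(K)` is the same thing as a bounded functional on the
projective tensor product and as a bounded map from `B(H)` to the dual of `B(K)`, with equal norms.
Separate ultraweak continuity of the form says exactly that the map is normal and takes values in
the predual. Inserting an isometric, ultraweakly bicontinuous automorphism `τ` of `B(K)` in the
second variable changes none of this; `exists_normalMap_equiv` is used with `τ` the transposition
for (1) and the identity for (2). The trace formula holds because a normal functional is the limit
of its values at `b P_F`, with `P_F` the finite projections of an orthonormal basis.

Positivity is reduced to the tensors `∑ Mᵢⱼ ⊗ |ζᵢ⟩⟨ζⱼ|` with `M ≥ 0`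
(`positiveOnInjectiveCone_iff`). These are positive operators. Conversely, if `x` is positive, its
compression by `1 ⊗ P_F` has this form, and `Ψ` of the compressions tends to `Ψ(x)`. With `J` the
conjugation, the transpose of `|ζᵢ⟩⟨ζⱼ|` is `|Jζⱼ⟩⟨Jζᵢ|`, so in (1) the test reads `∑ ⟨Jζᵢ, ψ(Mᵢⱼ)
Jζⱼ⟩ ≥ 0`, which is complete positivity. Without the transposition it is the same condition on `a ↦
φ(a)ᵗ`.

For (3), `a ↦ a ⊗ b` and `b ↦ a ⊗ b` are ultraweakly continuous into `B(H ⊗ K)`, so normal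
functionals restrict. Conversely, a functional positive on the injective cone is bounded for the
operator norm, because `1 ⊗ 1` is an order unit, and extends by Hahn-Banach to a bounded `f`. This
`f` need not be normal, but its density is positive with finite trace and so defines a positive
normal `ω`. The restriction of `ω` agrees with `Ψ` at tensors of rank one operators, hence
everywhere by normality of both. -/

namespace EntanglementMaps

/-! ### Ultraweak continuity and approximation by finite rank operators. -/

section Ultraweak

variable {H : Type*} [NormedAddCommGroup H] [InnerProductSpace ℂ H] [CompleteSpace H]

/-- Square-summable families over any index type give ultraweakly continuous functionals. -/
theorem continuous_ultraweak_tsum {J : Type*} {u v : J → H}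
    (hu : Summable fun j => ‖u j‖ ^ 2) (hv : Summable fun j => ‖v j‖ ^ 2) :
    Continuous[ultraweak H, inferInstance] fun x : H →L[ℂ] H => ∑' j, ⟪u j, x (v j)⟫_ℂ := by
  classical
  -- The support of a summable family is countable, so it embeds into `ℕ`; terms with `u j = 0`
  -- contribute nothing, whatever `v j` is.
  set S : Set J := Function.support fun j => ‖u j‖ ^ 2 with hS
  have hc : Countable S := hu.countable_support.to_subtype
  obtain ⟨f, hf⟩ := hc.exists_injective_nat
  have key : ∀ w : J → H, (Summable fun j => ‖w j‖ ^ 2) →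
      Summable fun n => ‖Function.extend f (fun s : S => w s) 0 n‖ ^ 2 := by
    intro w hw
    have h1 : Summable fun s : S => ‖w s‖ ^ 2 := hw.subtype S
    have h2 := (summable_extend_zero hf).2 h1
    convert h2 using 2 with n
    by_cases hn : ∃ s, f s = n
    · obtain ⟨s, rfl⟩ := hn
      simp [hf.extend_apply]
    · simp [Function.extend_apply' _ _ _ hn]
  have h : (fun x : H →L[ℂ] H => ∑' j, ⟪u j, x (v j)⟫_ℂ) = fun x : H →L[ℂ] H =>
      ∑' n, ⟪Function.extend f (fun s : S => u s) 0 n,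
        x (Function.extend f (fun s : S => v s) 0 n)⟫_ℂ := by
    funext x
    have h1 : ∑' j, ⟪u j, x (v j)⟫_ℂ = ∑' s : S, ⟪u s, x (v s)⟫_ℂ := by
      symm
      refine tsum_subtype_eq_of_support_subset (f := fun j => ⟪u j, x (v j)⟫_ℂ) ?_
      intro j hj
      simp only [hS, Function.mem_support, ne_eq] at hj ⊢
      rintro h0
      simp [(by simpa using h0 : u j = 0)] at hj
    rw [h1, ← tsum_extend_zero hf]
    congr 1
    funext n
    by_cases hn : ∃ s, f s = n
    · obtain ⟨s, rfl⟩ := hn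
      simp [hf.extend_apply]
    · simp [Function.extend_apply' _ _ _ hn]
  rw [h]
  exact continuous_iInf_dom (i := ⟨(_, _), key u hu, key v hv⟩) continuous_induced_dom

/-- Bounded families that converge in the weak operator topology converge ultraweakly. -/
theorem tendsto_ultraweak {α : Type*} {l : Filter α} {F : α → H →L[ℂ] H} {x : H →L[ℂ] H} {C : ℝ}
    (hF : ∀ a, ‖F a‖ ≤ C) (hx : ∀ u v : H, Tendsto (fun a => ⟪u, F a v⟫_ℂ) l (𝓝 ⟪u, x v⟫_ℂ)) :
    Tendsto F l (@nhds _ (ultraweak H) x) := by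
  rw [nhds_iInf, tendsto_iInf]
  rintro ⟨⟨u, v⟩, hu, hv⟩
  rw [nhds_induced, tendsto_comap_iff]
  refine tendsto_tsum_of_dominated_convergence
    (bound := fun n => C * ((‖u n‖ ^ 2 + ‖v n‖ ^ 2) / 2)) (((hu.add hv).div_const _).mul_left _)
    (fun n => hx _ _) (Eventually.of_forall fun a n => ?_)
  calc ‖⟪u n, F a (v n)⟫_ℂ‖ ≤ ‖u n‖ * (‖F a‖ * ‖v n‖) :=
        (norm_inner_le_norm _ _).trans (by gcongr; exact (F a).le_opNorm _)
    _ = ‖F a‖ * (‖u n‖ * ‖v n‖) := by ring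
    _ ≤ C * ((‖u n‖ ^ 2 + ‖v n‖ ^ 2) / 2) := by
        have := (norm_nonneg _).trans (hF a)
        gcongr
        · exact hF a
        · nlinarith [sq_nonneg (‖u n‖ - ‖v n‖)]

theorem tendsto_of_continuous_ultraweak {α : Type*} {l : Filter α} {F : α → H →L[ℂ] H}
    {x : H →L[ℂ] H} {C : ℝ} {f : (H →L[ℂ] H) → ℂ} (hf : Continuous[ultraweak H, inferInstance] f)
    (hF : ∀ a, ‖F a‖ ≤ C) (hx : ∀ u v : H, Tendsto (fun a => ⟪u, F a v⟫_ℂ) l (𝓝 ⟪u, x v⟫_ℂ)) :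
    Tendsto (fun a => f (F a)) l (𝓝 (f x)) := by
  let _ := ultraweak H
  exact (hf.tendsto x).comp (tendsto_ultraweak hF hx)

/-- The orthogonal projection onto the span of finitely many orthonormal vectors. -/
def orthoProj {J : Type*} (g : J → H) (F : Finset J) : H →L[ℂ] H :=
  ∑ i ∈ F, rankOne ℂ (g i) (g i)

theorem orthoProj_apply {J : Type*} (g : J → H) (F : Finset J) (x : H) :
    orthoProj g F x = ∑ i ∈ F, ⟪g i, x⟫_ℂ • g i := by
  simp [orthoProj]

/-- This is Bessel's inequality. -/
theorem norm_orthoProj_le {J : Type*} {g : J → H} (hg : Orthonormal ℂ g) (F : Finset J) :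
    ‖orthoProj g F‖ ≤ 1 := by
  refine ContinuousLinearMap.opNorm_le_bound _ zero_le_one fun x => ?_
  have h := hg.sum_inner_products_le x (s := F)
  have h2 : ‖orthoProj g F x‖ ^ 2 = ∑ i ∈ F, ‖⟪g i, x⟫_ℂ‖ ^ 2 := by
    have := hg.inner_sum (fun i => ⟪g i, x⟫_ℂ) (fun i => ⟪g i, x⟫_ℂ) F
    rw [← orthoProj_apply, inner_self_eq_norm_sq_to_K] at this
    simp only [RCLike.conj_mul] at this
    exact_mod_cast this
  rw [← h2] at h
  rw [one_mul]
  exact (sq_le_sq₀ (norm_nonneg _) (norm_nonneg _)).1 h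

theorem inner_orthoProj_left {J : Type*} (g : J → H) (F : Finset J) (x y : H) :
    ⟪orthoProj g F x, y⟫_ℂ = ⟪x, orthoProj g F y⟫_ℂ := by
  simp only [orthoProj_apply, sum_inner, inner_sum, inner_smul_left, inner_smul_right,
    inner_conj_symm]
  exact Finset.sum_congr rfl fun i _ => mul_comm _ _

theorem tendsto_orthoProj {J : Type*} (g : HilbertBasis J ℂ H) (x : H) :
    Tendsto (fun F => orthoProj g F x) atTop (𝓝 x) := by
  have := g.hasSum_repr x
  simp only [HilbertBasis.repr_apply_apply] at this
  simpa only [orthoProj_apply, HasSum, SummationFilter.unconditional_filter] using this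

theorem tendsto_apply_mul_orthoProj {J : Type*} (g : HilbertBasis J ℂ H) {f : (H →L[ℂ] H) → ℂ}
    (hf : Continuous[ultraweak H, inferInstance] f) (b : H →L[ℂ] H) :
    Tendsto (fun F => f (b ∘SL orthoProj g F)) atTop (𝓝 (f b)) := by
  refine tendsto_of_continuous_ultraweak (C := ‖b‖) hf (fun F => ?_) fun u v => ?_
  · calc ‖b ∘SL orthoProj g F‖ ≤ ‖b‖ * ‖orthoProj g F‖ := ContinuousLinearMap.opNorm_comp_le _ _
      _ ≤ ‖b‖ := mul_le_of_le_one_right (norm_nonneg _) (norm_orthoProj_le g.orthonormal F)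
  · exact tendsto_const_nhds.inner ((b.continuous.tendsto _).comp (tendsto_orthoProj g v))

/-- Compression on both sides, unlike multiplication on one side, preserves positivity; the
positivity criterion on the injective cone depends on it. -/
theorem tendsto_apply_orthoProj_mul_orthoProj {J : Type*} (g : HilbertBasis J ℂ H)
    {f : (H →L[ℂ] H) → ℂ} (hf : Continuous[ultraweak H, inferInstance] f) (b : H →L[ℂ] H) :
    Tendsto (fun F => f (orthoProj g F ∘SL b ∘SL orthoProj g F)) atTop (𝓝 (f b)) := by
  refine tendsto_of_continuous_ultraweak (C := ‖b‖) hf (fun F => ?_) fun u v => ?_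
  · calc ‖orthoProj g F ∘SL b ∘SL orthoProj g F‖
        ≤ ‖orthoProj g F‖ * (‖b‖ * ‖orthoProj g F‖) :=
          (ContinuousLinearMap.opNorm_comp_le _ _).trans
            (by gcongr; exact ContinuousLinearMap.opNorm_comp_le _ _)
      _ ≤ 1 * (‖b‖ * 1) := by gcongr <;> exact norm_orthoProj_le g.orthonormal F
      _ = ‖b‖ := by ring
  · have h : ∀ F, ⟪u, (orthoProj g F ∘SL b ∘SL orthoProj g F) v⟫_ℂ =
        ⟪orthoProj g F u, b (orthoProj g F v)⟫_ℂ := fun F => by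
      rw [inner_orthoProj_left]; rfl
    simp only [h]
    exact (tendsto_orthoProj g u).inner ((b.continuous.tendsto _).comp (tendsto_orthoProj g v))

theorem comp_orthoProj {J : Type*} (g : J → H) (F : Finset J) (b : H →L[ℂ] H) :
    b ∘SL orthoProj g F = ∑ i ∈ F, rankOne ℂ (b (g i)) (g i) := by
  ext x
  simp [orthoProj_apply, map_sum]

theorem continuous_of_mem_predual {f : (H →L[ℂ] H) →L[ℂ] ℂ} (hf : f ∈ Predual H) :
    Continuous[ultraweak H, inferInstance] fun x => f x := hf

/-- A normal functional is `b ↦ Tr (T b)`, where `T` is its density. -/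
theorem hasTrace_density_comp {f : (H →L[ℂ] H) →L[ℂ] ℂ} (hf : f ∈ Predual H) (b : H →L[ℂ] H) :
    HasTrace (density f ∘SL b) (f b) := by
  intro s g
  -- The values `f (b P_F)` are the partial sums of the trace: `f (|b gᵢ⟩⟨gᵢ|) = ⟨gᵢ, T b gᵢ⟩` for
  -- the density `T`.
  have := tendsto_apply_mul_orthoProj g (continuous_of_mem_predual hf) b
  simp only [comp_orthoProj, map_sum] at this
  simpa only [HasSum, SummationFilter.unconditional_filter, ContinuousLinearMap.comp_apply, inner_density] using this

/-- A normal functional is determined by its values at operators of rank one. -/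
theorem eq_of_forall_rankOne {f g : (H →L[ℂ] H) →ₗ[ℂ] ℂ}
    (hf : Continuous[ultraweak H, inferInstance] fun x => f x)
    (hg : Continuous[ultraweak H, inferInstance] fun x => g x)
    (h : ∀ v w : H, f (rankOne ℂ v w) = g (rankOne ℂ v w)) : f = g := by
  ext b
  obtain ⟨s, e, -⟩ := exists_hilbertBasis ℂ H
  refine tendsto_nhds_unique (tendsto_apply_mul_orthoProj e hf b) ?_
  convert tendsto_apply_mul_orthoProj e hg b using 2 with F
  simp only [comp_orthoProj, map_sum, h]

theorem HasTrace.sum {J : Type*} {F : Finset J} {T : J → H →L[ℂ] H} {z : J → ℂ}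
    (h : ∀ i ∈ F, HasTrace (T i) (z i)) : HasTrace (∑ i ∈ F, T i) (∑ i ∈ F, z i) := fun s g => by
  simpa only [sum_apply, inner_sum] using hasSum_sum fun i hi => h i hi s g

end Ultraweak

/-! ### Conjugation and transposition with respect to a basis. -/

section Transpose

variable {H : Type*} [NormedAddCommGroup H] [InnerProductSpace ℂ H] [CompleteSpace H]
  {ι : Type*} (e : HilbertBasis ι ℂ H)

theorem conjugation_conjugation (x : H) : conjugation e (conjugation e x) = x := by
  simp [conjugation]

theorem norm_conjugation (x : H) : ‖conjugation e x‖ = ‖x‖ := by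
  simp [conjugation]

/-- Both sides are expanded by Parseval; conjugating the coefficients swaps the two arguments. -/
theorem inner_conjugation_conjugation (x y : H) :
    ⟪conjugation e x, conjugation e y⟫_ℂ = ⟪y, x⟫_ℂ := by
  rw [← (e.hasSum_inner_mul_inner (conjugation e x) (conjugation e y)).tsum_eq,
    ← (e.hasSum_inner_mul_inner y x).tsum_eq]
  refine tsum_congr fun i => ?_
  rw [inner_conjugation, ← inner_conj_symm (conjugation e x), inner_conjugation,
    ← inner_conj_symm y]
  simp [mul_comm]

theorem inner_conjugation_left (x y : H) :
    ⟪conjugation e x, y⟫_ℂ = ⟪conjugation e y, x⟫_ℂ := by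
  conv_lhs => rw [← conjugation_conjugation e y]
  exact inner_conjugation_conjugation e _ _

theorem inner_transpose_apply (b : H →L[ℂ] H) (u v : H) :
    ⟪u, transpose e b v⟫_ℂ = ⟪conjugation e v, b (conjugation e u)⟫_ℂ := by
  rw [← inner_conj_symm]
  simp only [transpose, ContinuousLinearMap.comp_apply]
  rw [inner_conjugation_left, ContinuousLinearMap.adjoint_inner_right, inner_conj_symm]

theorem transpose_transpose (b : H →L[ℂ] H) : transpose e (transpose e b) = b := by
  refine ContinuousLinearMap.ext fun v => ext_inner_left ℂ fun u => ?_
  rw [inner_transpose_apply, inner_transpose_apply, conjugation_conjugation,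
    conjugation_conjugation]

theorem norm_transpose_le (b : H →L[ℂ] H) : ‖transpose e b‖ ≤ ‖b‖ := by
  refine ContinuousLinearMap.opNorm_le_bound _ (norm_nonneg _) fun x => ?_
  simp only [transpose, ContinuousLinearMap.comp_apply, norm_conjugation]
  refine (ContinuousLinearMap.le_opNorm _ _).trans_eq ?_
  rw [norm_conjugation]
  simp

theorem transpose_rankOne (v w : H) :
    transpose e (rankOne ℂ v w) = rankOne ℂ (conjugation e w) (conjugation e v) := by
  refine ContinuousLinearMap.ext fun y => ext_inner_left ℂ fun x => ?_
  rw [inner_transpose_apply]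
  simp only [rankOne_apply, inner_smul_right]
  rw [inner_conjugation_left e y v, ← inner_conj_symm w, inner_conjugation_left e x w,
    inner_conj_symm, mul_comm]

/-- Transposition as an isometric automorphism of the Banach space `B(H)`. -/
def transposeₗᵢ : (H →L[ℂ] H) ≃ₗᵢ[ℂ] (H →L[ℂ] H) where
  toFun := transpose e
  invFun := transpose e
  left_inv := transpose_transpose e
  right_inv := transpose_transpose e
  map_add' a b := by
    refine ContinuousLinearMap.ext fun v => ext_inner_left ℂ fun u => ?_
    simp [inner_transpose_apply, inner_add_right]
  map_smul' c b := by
    refine ContinuousLinearMap.ext fun v => ext_inner_left ℂ fun u => ?_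
    simp [inner_transpose_apply, inner_smul_right]
  norm_map' b := le_antisymm (norm_transpose_le e b)
    (by simpa [transpose_transpose] using norm_transpose_le e (transpose e b))

/-- Transposition turns the functional of the families `(u, v)` into that of `(Jv, Ju)`, and `J`
preserves square-summability. -/
theorem continuous_transpose :
    Continuous[ultraweak H, ultraweak H] (transpose e) := by
  refine continuous_iInf_rng.2 ?_
  rintro ⟨⟨u, v⟩, hu, hv⟩
  rw [continuous_induced_rng]
  simp only [Function.comp_def, inner_transpose_apply]
  exact continuous_ultraweak_tsum (by simpa only [norm_conjugation] using hv)
    (by simpa only [norm_conjugation] using hu)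

end Transpose

/-! ### Normal maps and functionals on the projective tensor product. -/

section Functionals

variable {H K : Type*} [NormedAddCommGroup H] [InnerProductSpace ℂ H] [CompleteSpace H]
  [NormedAddCommGroup K] [InnerProductSpace ℂ K] [CompleteSpace K]

theorem algTensor_induction {P : AlgTensor H K → Prop} (h0 : P 0)
    (ht : ∀ (a : H →L[ℂ] H) (b : K →L[ℂ] K), P (tmul a b))
    (hadd : ∀ x y, P x → P y → P (x + y)) (x : AlgTensor H K) : P x :=
  TensorProduct.induction_on (motive := P) x h0 ht hadd

theorem norm_tmul_le (a : H →L[ℂ] H) (b : K →L[ℂ] K) : ‖tmul a b‖ ≤ ‖a‖ * ‖b‖ :=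
  csInf_le (projCosts_bddBelow _) ⟨[(a, b)], by simp, by simp⟩

/-- The algebraic tensor product, as a dense subspace of the projective tensor product. -/
def ofAlg : AlgTensor H K →L[ℂ] ProjTensor H K := UniformSpace.Completion.toComplL

theorem ofAlg_apply (x : AlgTensor H K) : ofAlg x = (x : ProjTensor H K) := rfl

/-- The elementary tensor as a bilinear map. -/
def tmulₗ : (H →L[ℂ] H) →ₗ[ℂ] (K →L[ℂ] K) →ₗ[ℂ] AlgTensor H K :=
  TensorProduct.mk ℂ (H →L[ℂ] H) (K →L[ℂ] K)

theorem tmulₗ_apply (a : H →L[ℂ] H) (b : K →L[ℂ] K) : tmulₗ a b = tmul a b := rfl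

theorem ext_projTensor {Φ Ψ : ProjTensor H K →L[ℂ] ℂ}
    (h : ∀ a b, Φ (tmul a b : AlgTensor H K) = Ψ (tmul a b : AlgTensor H K)) : Φ = Ψ := by
  apply ContinuousLinearMap.coeFn_injective
  refine UniformSpace.Completion.ext Φ.continuous Ψ.continuous fun x => ?_
  induction x using algTensor_induction with
  | h0 => rw [UniformSpace.Completion.coe_zero, map_zero, map_zero]
  | ht a b => exact h a b
  | hadd x y hx hy => rw [UniformSpace.Completion.coe_add, map_add, map_add, hx, hy]

/-- The linear functional on `B(H) ⊙ B(K)` given by a bilinear form. -/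
def liftAlg (β : (H →L[ℂ] H) →ₗ[ℂ] (K →L[ℂ] K) →ₗ[ℂ] ℂ) : AlgTensor H K →ₗ[ℂ] ℂ :=
  TensorProduct.lift β

theorem liftAlg_tmul (β : (H →L[ℂ] H) →ₗ[ℂ] (K →L[ℂ] K) →ₗ[ℂ] ℂ) (a : H →L[ℂ] H)
    (b : K →L[ℂ] K) : liftAlg β (tmul a b) = β a b := TensorProduct.lift.tmul _ _

/-- The bound holds for the cost of each representation of `x`, by induction on its length, and
therefore for the infimum. -/
theorem norm_liftAlg_le {β : (H →L[ℂ] H) →ₗ[ℂ] (K →L[ℂ] K) →ₗ[ℂ] ℂ} {C : ℝ} (hC : 0 ≤ C)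
    (hβ : ∀ a b, ‖β a b‖ ≤ C * (‖a‖ * ‖b‖)) (x : AlgTensor H K) : ‖liftAlg β x‖ ≤ C * ‖x‖ := by
  change _ ≤ C * sInf (projCosts x)
  rw [← smul_eq_mul, ← Real.sInf_smul_of_nonneg hC]
  refine le_csInf (projCosts_nonempty x).smul_set ?_
  rintro _ ⟨_, ⟨l, rfl, rfl⟩, rfl⟩
  induction l with
  | nil => simp
  | cons p l ih =>
    simp only [List.map_cons, List.sum_cons, map_add, smul_eq_mul, mul_add] at ih ⊢
    refine (norm_add_le _ _).trans (add_le_add ?_ ih)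
    rw [liftAlg_tmul]
    exact hβ _ _

/-- A bounded bilinear form extends to a functional on the projective tensor product. -/
theorem exists_projTensor_functional {β : (H →L[ℂ] H) →ₗ[ℂ] (K →L[ℂ] K) →ₗ[ℂ] ℂ} {C : ℝ}
    (hC : 0 ≤ C) (hβ : ∀ a b, ‖β a b‖ ≤ C * (‖a‖ * ‖b‖)) :
    ∃ Φ : ProjTensor H K →L[ℂ] ℂ, ‖Φ‖ ≤ C ∧ ∀ x : AlgTensor H K, Φ x = liftAlg β x := by
  set f : AlgTensor H K →L[ℂ] ℂ := (liftAlg β).mkContinuous C (norm_liftAlg_le hC hβ) with hf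
  have key : ∀ x : AlgTensor H K, f.extend (ofAlg (H := H) (K := K)) x = liftAlg β x := fun x =>
    ContinuousLinearMap.extend_eq f UniformSpace.Completion.denseRange_coe
      (UniformSpace.Completion.isUniformInducing_coe _) x
  refine ⟨f.extend ofAlg, ContinuousLinearMap.opNorm_le_bound _ hC fun x => ?_, key⟩
  induction x using UniformSpace.Completion.induction_on with
  | hp => exact isClosed_le (by fun_prop) (by fun_prop)
  | ih x =>
    rw [key, UniformSpace.Completion.norm_coe]
    exact norm_liftAlg_le hC hβ x

theorem normalMap_apply_continuous (φ : NormalMap H K) (b : K →L[ℂ] K) :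
    Continuous[ultraweak H, inferInstance] fun a : H →L[ℂ] H =>
      (((φ : (H →L[ℂ] H) →L[ℂ] Predual K) a : Predual K) : (K →L[ℂ] K) →L[ℂ] ℂ) b := by
  have h : Continuous[ultraweak H, predualWeak K] fun a => (φ : (H →L[ℂ] H) →L[ℂ] Predual K) a :=
    φ.2
  let _ := ultraweak H
  exact continuous_induced_rng.1 (continuous_iInf_rng.1 h b)

theorem norm_normalMap_apply_le (φ : NormalMap H K) (a : H →L[ℂ] H) (b : K →L[ℂ] K) :
    ‖(((φ : (H →L[ℂ] H) →L[ℂ] Predual K) a : Predual K) : (K →L[ℂ] K) →L[ℂ] ℂ) b‖ ≤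
      ‖φ‖ * (‖a‖ * ‖b‖) := by
  refine (ContinuousLinearMap.le_opNorm _ _).trans ?_
  rw [← mul_assoc]
  gcongr
  exact (φ : (H →L[ℂ] H) →L[ℂ] Predual K).le_opNorm a

variable (τ : (K →L[ℂ] K) ≃ₗᵢ[ℂ] (K →L[ℂ] K))

/-- The bilinear form `(a, b) ↦ φ(a)(τ b)`. -/
def pairing (φ : NormalMap H K) : (H →L[ℂ] H) →ₗ[ℂ] (K →L[ℂ] K) →ₗ[ℂ] ℂ :=
  LinearMap.mk₂ ℂ (fun a b => (((φ : (H →L[ℂ] H) →L[ℂ] Predual K) a : Predual K) :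
    (K →L[ℂ] K) →L[ℂ] ℂ) (τ b)) (by simp) (by simp) (by simp) (by simp)

theorem exists_functional_of_normalMap (hτ : Continuous[ultraweak K, ultraweak K] τ)
    (φ : NormalMap H K) : ∃ Φ : NormalFunctional H K, ‖Φ‖ ≤ ‖φ‖ ∧ ∀ a b,
      (Φ : ProjTensor H K →L[ℂ] ℂ) (tmul a b : AlgTensor H K) =
        (((φ : (H →L[ℂ] H) →L[ℂ] Predual K) a : Predual K) : (K →L[ℂ] K) →L[ℂ] ℂ) (τ b) := by
  obtain ⟨Φ, h1, h2⟩ := exists_projTensor_functional (β := pairing τ φ) (norm_nonneg φ)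
    fun a b => (norm_normalMap_apply_le φ a (τ b)).trans_eq (by rw [τ.norm_map])
  have h3 : ∀ a b, Φ (tmul a b : AlgTensor H K) =
      (((φ : (H →L[ℂ] H) →L[ℂ] Predual K) a : Predual K) : (K →L[ℂ] K) →L[ℂ] ℂ) (τ b) :=
    fun a b => by rw [h2, liftAlg_tmul]; rfl
  refine ⟨⟨Φ, fun b => ?_, fun a => ?_⟩, h1, h3⟩
  · simp only [h3]
    exact normalMap_apply_continuous φ (τ b)
  · simp only [h3]
    let _ := ultraweak K
    exact (continuous_of_mem_predual
      ((φ : (H →L[ℂ] H) →L[ℂ] Predual K) a).2).comp hτ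

theorem norm_functional_tmul_le (Φ : ProjTensor H K →L[ℂ] ℂ) (a : H →L[ℂ] H) (b : K →L[ℂ] K) :
    ‖Φ (tmul a b : AlgTensor H K)‖ ≤ ‖Φ‖ * ‖a‖ * ‖b‖ := by
  refine (Φ.le_opNorm _).trans ?_
  rw [UniformSpace.Completion.norm_coe, mul_assoc]
  gcongr
  exact norm_tmul_le a b

/-- Elementary tensors have projective norm at most `‖a‖ ‖b‖`, and `τ` is isometric and onto, so
they already bound the norm of `φ`. -/
theorem norm_normalMap_le_of_apply {Φ : ProjTensor H K →L[ℂ] ℂ} {φ : NormalMap H K}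
    (h : ∀ a b, Φ (tmul a b : AlgTensor H K) =
      (((φ : (H →L[ℂ] H) →L[ℂ] Predual K) a : Predual K) : (K →L[ℂ] K) →L[ℂ] ℂ) (τ b)) :
    ‖φ‖ ≤ ‖Φ‖ := by
  refine ContinuousLinearMap.opNorm_le_bound _ (norm_nonneg _) fun a => ?_
  refine ContinuousLinearMap.opNorm_le_bound _ (by positivity) fun b => ?_
  have := norm_functional_tmul_le Φ a (τ.symm b)
  rwa [h, τ.apply_symm_apply, τ.symm.norm_map] at this

theorem exists_normalMap_of_functional (hτ : Continuous[ultraweak K, ultraweak K] τ.symm)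
    (Φ : NormalFunctional H K) : ∃ φ : NormalMap H K, ∀ a b,
      (Φ : ProjTensor H K →L[ℂ] ℂ) (tmul a b : AlgTensor H K) =
        (((φ : (H →L[ℂ] H) →L[ℂ] Predual K) a : Predual K) : (K →L[ℂ] K) →L[ℂ] ℂ) (τ b) := by
  set B : (H →L[ℂ] H) →L[ℂ] (K →L[ℂ] K) →L[ℂ] ℂ := LinearMap.mkContinuous₂
    ((tmulₗ.compl₂ (τ.symm : (K →L[ℂ] K) →ₗ[ℂ] (K →L[ℂ] K))).compr₂
      ((Φ : ProjTensor H K →L[ℂ] ℂ) ∘SL ofAlg : AlgTensor H K →L[ℂ] ℂ).toLinearMap)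
    ‖Φ‖ (fun a b => by
      have := norm_functional_tmul_le (Φ : ProjTensor H K →L[ℂ] ℂ) a (τ.symm b)
      rwa [τ.symm.norm_map] at this) with hB
  have hBa : ∀ a b, B a b = (Φ : ProjTensor H K →L[ℂ] ℂ) (tmul a (τ.symm b) : AlgTensor H K) :=
    fun a b => rfl
  have hmem : ∀ a, B a ∈ Predual K := fun a => by
    change Continuous[ultraweak K, inferInstance] fun b => B a b
    simp only [hBa]
    let _ := ultraweak K
    exact (Φ.2.2 a).comp hτ
  refine ⟨⟨B.codRestrict _ hmem, ?_⟩, fun a b => ?_⟩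
  · let _ := ultraweak H
    refine continuous_iInf_rng.2 fun b => continuous_induced_rng.2 ?_
    exact Φ.2.1 (τ.symm b)
  · change _ = B a (τ b)
    rw [hBa, τ.symm_apply_apply]

/-- Normal maps into the predual are the normal functionals on the projective tensor product. -/
theorem exists_normalMap_equiv (hτ : Continuous[ultraweak K, ultraweak K] τ)
    (hτ' : Continuous[ultraweak K, ultraweak K] τ.symm) :
    ∃ Φ : NormalMap H K ≃ₗᵢ[ℂ] NormalFunctional H K, ∀ φ a b,
      (Φ φ : ProjTensor H K →L[ℂ] ℂ) (tmul a b : AlgTensor H K) =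
        (((φ : (H →L[ℂ] H) →L[ℂ] Predual K) a : Predual K) : (K →L[ℂ] K) →L[ℂ] ℂ) (τ b) := by
  choose F hF1 hF2 using exists_functional_of_normalMap (H := H) τ hτ
  have hadd : ∀ φ ψ, F (φ + ψ) = F φ + F ψ := fun φ ψ =>
    Subtype.ext <| ext_projTensor fun a b => by
      refine (hF2 (φ + ψ) a b).trans ?_
      exact congrArg₂ (· + ·) (hF2 φ a b).symm (hF2 ψ a b).symm
  have hsmul : ∀ (c : ℂ) φ, F (c • φ) = c • F φ := fun c φ =>
    Subtype.ext <| ext_projTensor fun a b => by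
      refine (hF2 (c • φ) a b).trans ?_
      exact congrArg (c • ·) (hF2 φ a b).symm
  have hnorm : ∀ φ, ‖F φ‖ = ‖φ‖ := fun φ => by
    refine le_antisymm (hF1 φ) ?_
    exact norm_normalMap_le_of_apply τ (hF2 φ)
  have hsurj : Function.Surjective F := fun Φ => by
    obtain ⟨φ, hφ⟩ := exists_normalMap_of_functional τ hτ' Φ
    refine ⟨φ, Subtype.ext <| ext_projTensor fun a b => ?_⟩
    rw [hF2, hφ]
  let G : NormalMap H K →ₗ[ℂ] NormalFunctional H K := ⟨⟨F, hadd⟩, hsmul⟩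
  have hinj : Function.Injective F := fun φ ψ h =>
    Subtype.ext <| ContinuousLinearMap.ext fun a => Subtype.ext <|
      ContinuousLinearMap.ext fun b => by
      rw [← τ.apply_symm_apply b, ← hF2, ← hF2, h]
  exact ⟨⟨LinearEquiv.ofBijective G ⟨hinj, hsurj⟩, hnorm⟩, hF2⟩

theorem hasTrace_traceClassMap_sum {Φ : ProjTensor H K →L[ℂ] ℂ} {φ : NormalMap H K}
    (h : ∀ a b, Φ (tmul a b : AlgTensor H K) =
      (((φ : (H →L[ℂ] H) →L[ℂ] Predual K) a : Predual K) : (K →L[ℂ] K) →L[ℂ] ℂ) (τ b))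
    {n : ℕ} (a : Fin n → H →L[ℂ] H) (b : Fin n → K →L[ℂ] K) :
    HasTrace (∑ i, traceClassMap φ (a i) ∘SL τ (b i))
      (Φ (∑ i, tmul (a i) (b i) : AlgTensor H K)) := by
  rw [← ofAlg_apply, map_sum, map_sum]
  simp only [ofAlg_apply, h]
  exact HasTrace.sum fun i _ =>
    hasTrace_density_comp ((φ : (H →L[ℂ] H) →L[ℂ] Predual K) (a i)).2 _

end Functionals

/-! ### Positivity of operator matrices through quadratic forms. -/

section Matrices

variable {H : Type*} [NormedAddCommGroup H] [InnerProductSpace ℂ H] [CompleteSpace H]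

/-- Over `ℂ`, a quadratic form with real values forces the operator to be self-adjoint. -/
theorem nonneg_iff_inner_nonneg (T : H →L[ℂ] H) : 0 ≤ T ↔ ∀ x, 0 ≤ ⟪x, T x⟫_ℂ := by
  rw [ContinuousLinearMap.nonneg_iff_isPositive]
  refine ⟨fun h x => h.inner_nonneg_right x, fun h => ?_⟩
  rw [ContinuousLinearMap.isPositive_iff_complex]
  intro x
  have hx : 0 ≤ ⟪T x, x⟫_ℂ := by
    rw [← inner_conj_symm]
    exact star_nonneg_iff.2 (h x)
  rw [Complex.nonneg_iff] at hx
  exact ⟨Complex.ext rfl hx.2, hx.1⟩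

/-- The operator on `Hⁿ` given by a matrix of operators. -/
def blockOperator {n : ℕ} (M : Fin n → Fin n → H →L[ℂ] H) :
    PiLp 2 (fun _ : Fin n => H) →L[ℂ] PiLp 2 (fun _ : Fin n => H) :=
  ∑ i, ∑ j, ContinuousLinearMap.adjoint (PiLp.proj 2 (fun _ : Fin n => H) i) ∘SL M i j ∘SL
    PiLp.proj 2 (fun _ : Fin n => H) j

theorem inner_blockOperator {n : ℕ} (M : Fin n → Fin n → H →L[ℂ] H)
    (x y : PiLp 2 (fun _ : Fin n => H)) :
    ⟪x, blockOperator M y⟫_ℂ = ∑ i, ∑ j, ⟪x i, M i j (y j)⟫_ℂ := by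
  simp [blockOperator, ContinuousLinearMap.adjoint_inner_right]

/-- The inclusion of the `i`-th summand into `Hⁿ`. -/
def blockInclusion (n : ℕ) (i : Fin n) : H →L[ℂ] PiLp 2 (fun _ : Fin n => H) :=
  (PiLp.continuousLinearEquiv 2 ℂ (fun _ : Fin n => H)).symm.toContinuousLinearMap ∘SL
    ContinuousLinearMap.single ℂ (fun _ : Fin n => H) i

theorem inner_blockInclusion {n : ℕ} (M : Fin n → Fin n → H →L[ℂ] H) (i j : Fin n) (u v : H) :
    ⟪blockInclusion n i u, blockOperator M (blockInclusion n j v)⟫_ℂ = ⟪u, M i j v⟫_ℂ := by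
  rw [inner_blockOperator, Finset.sum_eq_single i, Finset.sum_eq_single j]
  · simp [blockInclusion]
  · intro k _ hk
    simp [blockInclusion, hk]
  · simp
  · intro k _ hk
    simp [blockInclusion, hk]
  · simp

theorem exists_eq_adjoint_comp_self {T : H →L[ℂ] H} (hT : 0 ≤ T) :
    ∃ S : H →L[ℂ] H, T = ContinuousLinearMap.adjoint S ∘SL S :=
  CStarAlgebra.nonneg_iff_eq_star_mul_self.1 hT

theorem inner_star_mul_self_apply {n : ℕ} (N : CStarMatrix (Fin n) (Fin n) (H →L[ℂ] H))
    (i j : Fin n) (u v : H) : ⟪u, (star N * N) i j v⟫_ℂ = ∑ k, ⟪N k i u, N k j v⟫_ℂ := by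
  rw [CStarMatrix.mul_apply, sum_apply, inner_sum]
  refine Finset.sum_congr rfl fun k _ => ?_
  exact ContinuousLinearMap.adjoint_inner_right (N k i) _ _

/-- The order of the C⋆-algebra of matrices is generated by the elements `N* N`, whose quadratic
form is a sum of squares. Conversely, a nonnegative form makes the operator on `Hⁿ` positive, and
its factorization `S* S` is read off entry by entry. -/
theorem cstarMatrix_nonneg_iff {n : ℕ} (M : CStarMatrix (Fin n) (Fin n) (H →L[ℂ] H)) :
    0 ≤ M ↔ ∀ ξ : Fin n → H, 0 ≤ ∑ i, ∑ j, ⟪ξ i, M i j (ξ j)⟫_ℂ := by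
  constructor
  · intro hM ξ
    rw [StarOrderedRing.nonneg_iff] at hM
    induction hM using AddSubmonoid.closure_induction with
    | mem x hx =>
      obtain ⟨N, rfl⟩ := hx
      have h : ∑ i, ∑ j, ⟪ξ i, (star N * N) i j (ξ j)⟫_ℂ =
          ∑ k, ⟪∑ i, N k i (ξ i), ∑ j, N k j (ξ j)⟫_ℂ := by
        simp only [inner_star_mul_self_apply, inner_sum, sum_inner]
        refine (Finset.sum_congr rfl fun i _ => Finset.sum_comm).trans Finset.sum_comm |>.trans ?_
        exact Finset.sum_congr rfl fun k _ => Finset.sum_comm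
      beta_reduce
      rw [h]
      refine Finset.sum_nonneg fun k _ => ?_
      rw [inner_self_eq_norm_sq_to_K]
      positivity
    | zero => simp [CStarMatrix.zero_apply]
    | add x y _ _ hx hy =>
      simp only [CStarMatrix.add_apply, add_apply, inner_add_right, Finset.sum_add_distrib]
      exact add_nonneg hx hy
  · intro h
    have hT : 0 ≤ blockOperator fun i j => M i j := by
      rw [nonneg_iff_inner_nonneg]
      intro x
      rw [inner_blockOperator]
      exact h x
    obtain ⟨S, hS⟩ := exists_eq_adjoint_comp_self hT
    -- The entries of `N` are the blocks of `S`.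
    have hM : M = star (CStarMatrix.ofMatrix fun k j =>
        PiLp.proj 2 (fun _ : Fin n => H) k ∘SL S ∘SL blockInclusion n j) *
        (CStarMatrix.ofMatrix fun k j =>
        PiLp.proj 2 (fun _ : Fin n => H) k ∘SL S ∘SL blockInclusion n j) := by
      refine CStarMatrix.ext fun i j =>
        ContinuousLinearMap.ext fun v => ext_inner_left ℂ fun u => ?_
      rw [inner_star_mul_self_apply, ← inner_blockInclusion (fun i j => M i j), hS,
        ContinuousLinearMap.comp_apply, ContinuousLinearMap.adjoint_inner_right, PiLp.inner_apply]
      rfl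
    rw [hM]
    exact star_mul_self_nonneg _

end Matrices

/-! ### Positivity on the injective cone and complete positivity. -/

section Tensor

variable {H K : Type*} [NormedAddCommGroup H] [InnerProductSpace ℂ H] [CompleteSpace H]
  [NormedAddCommGroup K] [InnerProductSpace ℂ K] [CompleteSpace K]

/-- The map `ξ ↦ ξ ⊗ ζ` from `H` to the Hilbert space tensor product. -/
def tensorRight (ζ : K) : H →L[ℂ] HilbertTensor H K :=
  UniformSpace.Completion.toComplL ∘SL (TensorProduct.mkL ℂ H K).flip ζ

theorem tensorRight_apply (ζ : K) (ξ : H) :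
    tensorRight ζ ξ = ((ξ ⊗ₜ[ℂ] ζ : H ⊗[ℂ] K) : HilbertTensor H K) := rfl

theorem ext_hilbertTensor {E : Type*} [NormedAddCommGroup E] [NormedSpace ℂ E]
    {S T : HilbertTensor H K →L[ℂ] E} (h : ∀ (ξ : H) (η : K),
      S ((ξ ⊗ₜ[ℂ] η : H ⊗[ℂ] K) : HilbertTensor H K) =
        T ((ξ ⊗ₜ[ℂ] η : H ⊗[ℂ] K) : HilbertTensor H K)) : S = T := by
  apply ContinuousLinearMap.coeFn_injective
  refine UniformSpace.Completion.ext S.continuous T.continuous fun x => ?_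
  induction x using TensorProduct.induction_on with
  | zero => rw [UniformSpace.Completion.coe_zero, map_zero, map_zero]
  | tmul ξ η => exact h ξ η
  | add x y hx hy => rw [UniformSpace.Completion.coe_add, map_add, map_add, hx, hy]

theorem adjoint_tensorRight_apply (ζ η : K) (ξ : H) :
    ContinuousLinearMap.adjoint (tensorRight (H := H) ζ)
      ((ξ ⊗ₜ[ℂ] η : H ⊗[ℂ] K) : HilbertTensor H K) = ⟪ζ, η⟫_ℂ • ξ := by
  refine ext_inner_left ℂ fun u => ?_
  rw [ContinuousLinearMap.adjoint_inner_right, tensorRight_apply,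
    UniformSpace.Completion.inner_coe, TensorProduct.inner_tmul, inner_smul_right, mul_comm]

theorem toOperator_tmul_rankOne (a : H →L[ℂ] H) (v w : K) :
    toOperator H K (tmul a (rankOne ℂ v w)) =
      tensorRight v ∘SL a ∘SL ContinuousLinearMap.adjoint (tensorRight w) := by
  refine ext_hilbertTensor fun ξ η => ?_
  simp only [toOperator_tmul, ContinuousLinearMap.comp_apply, adjoint_tensorRight_apply, map_smul,
    tensorRight_apply, rankOne_apply]
  rw [TensorProduct.tmul_smul, UniformSpace.Completion.coe_smul]

/-- With `Rᵢ = tensorRight (ζ i)`, the operator is `∑ Rᵢ Mᵢⱼ Rⱼ*`, so its form at `z` is the form of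
`M` at the vectors `Rᵢ* z`. -/
theorem toOperator_sum_rankOne_nonneg {n : ℕ} {M : CStarMatrix (Fin n) (Fin n) (H →L[ℂ] H)}
    (hM : 0 ≤ M) (ζ : Fin n → K) :
    0 ≤ toOperator H K (∑ i, ∑ j, tmul (M i j) (rankOne ℂ (ζ i) (ζ j))) := by
  rw [nonneg_iff_inner_nonneg]
  intro z
  simp only [map_sum, toOperator_tmul_rankOne, sum_apply, inner_sum,
    ContinuousLinearMap.comp_apply]
  simp only [← ContinuousLinearMap.adjoint_inner_left (tensorRight _)]
  exact (cstarMatrix_nonneg_iff M).1 hM fun i =>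
    ContinuousLinearMap.adjoint (tensorRight (ζ i)) z

/-- The block `(1 ⊗ ⟨v|) X (1 ⊗ |w⟩)` of an operator `X` on the tensor product. -/
def slice (X : HilbertTensor H K →L[ℂ] HilbertTensor H K) (v w : K) : H →L[ℂ] H :=
  ContinuousLinearMap.adjoint (tensorRight v) ∘SL X ∘SL tensorRight w

theorem slice_toOperator_tmul (a : H →L[ℂ] H) (b : K →L[ℂ] K) (v w : K) :
    slice (toOperator H K (tmul a b)) v w = ⟪v, b w⟫_ℂ • a := by
  ext ξ
  simp [slice, tensorRight_apply, toOperator_tmul, adjoint_tensorRight_apply]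

theorem slice_add (X Y : HilbertTensor H K →L[ℂ] HilbertTensor H K) (v w : K) :
    slice (X + Y) v w = slice X v w + slice Y v w := by
  ext ξ
  simp [slice]

theorem inner_slice (X : HilbertTensor H K →L[ℂ] HilbertTensor H K) (v w : K) (ξ η : H) :
    ⟪ξ, slice X v w η⟫_ℂ = ⟪tensorRight v ξ, X (tensorRight w η)⟫_ℂ := by
  rw [slice, ContinuousLinearMap.comp_apply, ContinuousLinearMap.adjoint_inner_right,
    ContinuousLinearMap.comp_apply]

/-- The matrix of blocks of an operator on the tensor product. -/
def sliceMatrix (X : HilbertTensor H K →L[ℂ] HilbertTensor H K) {n : ℕ} (ζ : Fin n → K) :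
    CStarMatrix (Fin n) (Fin n) (H →L[ℂ] H) :=
  CStarMatrix.ofMatrix fun i j => slice X (ζ i) (ζ j)

theorem sliceMatrix_apply (X : HilbertTensor H K →L[ℂ] HilbertTensor H K) {n : ℕ} (ζ : Fin n → K)
    (i j : Fin n) : sliceMatrix X ζ i j = slice X (ζ i) (ζ j) := rfl

theorem sliceMatrix_nonneg {X : HilbertTensor H K →L[ℂ] HilbertTensor H K} (hX : 0 ≤ X) {n : ℕ}
    (ζ : Fin n → K) : 0 ≤ sliceMatrix X ζ := by
  rw [cstarMatrix_nonneg_iff]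
  intro ξ
  have h := (nonneg_iff_inner_nonneg X).1 hX (∑ i, tensorRight (ζ i) (ξ i))
  simp only [map_sum, sum_inner, inner_sum] at h
  rw [Finset.sum_comm] at h
  simpa only [sliceMatrix_apply, inner_slice] using h

theorem add_tmul (a a' : H →L[ℂ] H) (b : K →L[ℂ] K) : tmul (a + a') b = tmul a b + tmul a' b :=
  TensorProduct.add_tmul a a' b

theorem tmul_orthoProj_comp_orthoProj {J : Type*} (g : J → K) (F : Finset J) (a : H →L[ℂ] H)
    (b : K →L[ℂ] K) :
    tmul a (orthoProj g F ∘SL b ∘SL orthoProj g F) =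
      ∑ i ∈ F, ∑ j ∈ F, tmul (slice (toOperator H K (tmul a b)) (g i) (g j))
        (rankOne ℂ (g i) (g j)) := by
  have h : orthoProj g F ∘SL b ∘SL orthoProj g F =
      ∑ i ∈ F, ∑ j ∈ F, ⟪g i, b (g j)⟫_ℂ • rankOne ℂ (g i) (g j) := by
    ext x
    simp only [ContinuousLinearMap.comp_apply, orthoProj_apply, map_sum, map_smul, sum_apply,
      smul_apply, rankOne_apply, Finset.smul_sum, smul_smul]
    rw [Finset.sum_comm]
    refine Finset.sum_congr rfl fun i _ => Finset.sum_congr rfl fun j _ => ?_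
    rw [mul_comm]
  simp only [h, ← tmulₗ_apply, map_sum, map_smul]
  simp only [tmulₗ_apply, slice_toOperator_tmul]
  refine Finset.sum_congr rfl fun i _ => Finset.sum_congr rfl fun j _ => ?_
  exact (TensorProduct.smul_tmul' _ _ _)

/-- The sums are compressions of `x` by `1 ⊗ P_F`, written through the blocks of the operator of
`x`. They are additive in `x`, so elementary tensors suffice, and there only normality in the second
variable is used. -/
theorem tendsto_sum_slice {J : Type*} (g : HilbertBasis J ℂ K) (Ψ : NormalFunctional H K)
    (x : AlgTensor H K) :
    Tendsto (fun F : Finset J => (Ψ : ProjTensor H K →L[ℂ] ℂ)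
      (∑ i ∈ F, ∑ j ∈ F, tmul (slice (toOperator H K x) (g i) (g j))
        (rankOne ℂ (g i) (g j)) : AlgTensor H K)) atTop
      (𝓝 ((Ψ : ProjTensor H K →L[ℂ] ℂ) x)) := by
  induction x using algTensor_induction with
  | h0 =>
    have : ∀ v w : K, slice (0 : HilbertTensor H K →L[ℂ] HilbertTensor H K) v w = 0 :=
      fun v w => by ext; simp [slice]
    simp only [map_zero, this]
    simp [← tmulₗ_apply]
  | ht a b =>
    simp only [← tmul_orthoProj_comp_orthoProj]
    exact tendsto_apply_orthoProj_mul_orthoProj g (Ψ.2.2 a) b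
  | hadd x y hx hy =>
    simp only [map_add, slice_add, add_tmul, Finset.sum_add_distrib,
      UniformSpace.Completion.coe_add]
    exact hx.add hy

/-- Positivity on the injective cone, tested at positive matrices and finite families of vectors. -/
theorem positiveOnInjectiveCone_iff (Ψ : NormalFunctional H K) :
    PositiveOnInjectiveCone (Ψ : ProjTensor H K →L[ℂ] ℂ) ↔
      ∀ (n : ℕ) (M : CStarMatrix (Fin n) (Fin n) (H →L[ℂ] H)), 0 ≤ M → ∀ ζ : Fin n → K,
        0 ≤ ∑ i, ∑ j, (Ψ : ProjTensor H K →L[ℂ] ℂ)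
          (tmul (M i j) (rankOne ℂ (ζ i) (ζ j)) : AlgTensor H K) := by
  constructor
  · intro h n M hM ζ
    have := h _ (toOperator_sum_rankOne_nonneg hM ζ)
    simpa only [← ofAlg_apply, map_sum] using this
  · intro h x hx
    obtain ⟨s, g, -⟩ := exists_hilbertBasis ℂ K
    refine ge_of_tendsto' (tendsto_sum_slice g Ψ x) fun F => ?_
    -- The test is applied to the blocks of `x` along the basis vectors in `F`, enumerated by `Fin
    -- F.card`.
    have := h F.card _ (sliceMatrix_nonneg hx fun i => g (F.equivFin.symm i))
      fun i => g (F.equivFin.symm i)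
    simp only [← ofAlg_apply, map_sum] at this ⊢
    convert this using 1
    rw [← Finset.sum_coe_sort]
    refine Fintype.sum_equiv F.equivFin _ _ fun i => ?_
    rw [← Finset.sum_coe_sort]
    refine Fintype.sum_equiv F.equivFin _ _ fun j => ?_
    simp only [sliceMatrix_apply, Equiv.symm_apply_apply]

theorem isCompletelyPositive_iff (φ : (H →L[ℂ] H) → (K →L[ℂ] K)) :
    IsCompletelyPositive φ ↔
      ∀ (n : ℕ) (M : CStarMatrix (Fin n) (Fin n) (H →L[ℂ] H)), 0 ≤ M → ∀ ζ : Fin n → K,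
        0 ≤ ∑ i, ∑ j, ⟪ζ i, φ (M i j) (ζ j)⟫_ℂ := by
  simp only [IsCompletelyPositive, cstarMatrix_nonneg_iff, CStarMatrix.map_apply]

variable {ι : Type*} (e : HilbertBasis ι ℂ K)

theorem positiveOnInjectiveCone_iff_isCompletelyPositive {Ψ : NormalFunctional H K}
    {ψ : NormalMap H K} (h : ∀ a b, (Ψ : ProjTensor H K →L[ℂ] ℂ) (tmul a b : AlgTensor H K) =
      (((ψ : (H →L[ℂ] H) →L[ℂ] Predual K) a : Predual K) : (K →L[ℂ] K) →L[ℂ] ℂ)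
        (transpose e b)) :
    PositiveOnInjectiveCone (Ψ : ProjTensor H K →L[ℂ] ℂ) ↔
      IsCompletelyPositive (traceClassMap ψ) := by
  rw [positiveOnInjectiveCone_iff, isCompletelyPositive_iff]
  simp only [h, transpose_rankOne, traceClassMap, inner_density]
  -- The two tests differ by replacing `ζ` with `Jζ`, and `J` is an involution.
  refine forall₃_congr fun n M _ => ⟨fun hζ ζ => ?_, fun hζ ζ => hζ _⟩
  simpa only [conjugation_conjugation] using hζ fun i => conjugation e (ζ i)

theorem positiveOnInjectiveCone_iff_isCompletelyCopositive {Φ : NormalFunctional H K}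
    {φ : NormalMap H K} (h : ∀ a b, (Φ : ProjTensor H K →L[ℂ] ℂ) (tmul a b : AlgTensor H K) =
      (((φ : (H →L[ℂ] H) →L[ℂ] Predual K) a : Predual K) : (K →L[ℂ] K) →L[ℂ] ℂ) b) :
    PositiveOnInjectiveCone (Φ : ProjTensor H K →L[ℂ] ℂ) ↔
      IsCompletelyCopositive e (traceClassMap φ) := by
  rw [positiveOnInjectiveCone_iff, IsCompletelyCopositive, isCompletelyPositive_iff]
  simp only [h, inner_transpose_apply, traceClassMap, inner_density]
  refine forall₃_congr fun n M _ => ⟨fun hζ ζ => hζ _, fun hζ ζ => ?_⟩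
  simpa only [conjugation_conjugation] using hζ fun i => conjugation e (ζ i)

end Tensor

/-! ### Normality of amplifications. -/

section Amplification

variable {H E : Type*} [NormedAddCommGroup H] [InnerProductSpace ℂ H] [CompleteSpace H]
  [NormedAddCommGroup E] [InnerProductSpace ℂ E] [CompleteSpace E]

theorem summable_norm_mul_norm {J : Type*} {u v : J → H} (hu : Summable fun j => ‖u j‖ ^ 2)
    (hv : Summable fun j => ‖v j‖ ^ 2) : Summable fun j => ‖u j‖ * ‖v j‖ := by
  refine Summable.of_nonneg_of_le (fun j => by positivity) (fun j => ?_) ((hu.add hv).div_const 2)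
  nlinarith [sq_nonneg (‖u j‖ - ‖v j‖)]

theorem norm_inner_apply_le (x : H →L[ℂ] H) (u v : H) : ‖⟪u, x v⟫_ℂ‖ ≤ ‖x‖ * (‖u‖ * ‖v‖) := by
  refine (norm_inner_le_norm _ _).trans ?_
  calc ‖u‖ * ‖x v‖ ≤ ‖u‖ * (‖x‖ * ‖v‖) := by gcongr; exact x.le_opNorm v
    _ = ‖x‖ * (‖u‖ * ‖v‖) := by ring

theorem summable_inner_apply {J : Type*} {u v : J → H} (hu : Summable fun j => ‖u j‖ ^ 2)
    (hv : Summable fun j => ‖v j‖ ^ 2) (x : H →L[ℂ] H) : Summable fun j => ⟪u j, x (v j)⟫_ℂ :=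
  Summable.of_norm_bounded ((summable_norm_mul_norm hu hv).mul_left ‖x‖)
    fun _ => norm_inner_apply_le x _ _

/-- The normal functional given by two square-summable families. -/
theorem exists_predual_tsum {J : Type*} {u v : J → H} (hu : Summable fun j => ‖u j‖ ^ 2)
    (hv : Summable fun j => ‖v j‖ ^ 2) :
    ∃ ω : Predual H, ∀ x, (ω : (H →L[ℂ] H) →L[ℂ] ℂ) x = ∑' j, ⟪u j, x (v j)⟫_ℂ := by
  refine ⟨⟨LinearMap.mkContinuous
    { toFun := fun x => ∑' j, ⟪u j, x (v j)⟫_ℂ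
      map_add' := fun x y => ?_
      map_smul' := fun c x => ?_ } (∑' j, ‖u j‖ * ‖v j‖) fun x => ?_, ?_⟩, fun x => rfl⟩
  · simp only [add_apply, inner_add_right]
    exact (summable_inner_apply hu hv x).tsum_add (summable_inner_apply hu hv y)
  · simp only [smul_apply, inner_smul_right, RingHom.id_apply, smul_eq_mul, tsum_mul_left]
  · change ‖∑' j, ⟪u j, x (v j)⟫_ℂ‖ ≤ _
    rw [mul_comm, ← tsum_mul_left]
    exact tsum_of_norm_bounded ((summable_norm_mul_norm hu hv).mul_left ‖x‖).hasSum
      fun _ => norm_inner_apply_le x _ _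
  · exact continuous_ultraweak_tsum hu hv

theorem hasSum_norm_sq_of_hasSum_inner {E J : Type*} [NormedAddCommGroup E]
    [InnerProductSpace ℂ E] {f : J → H} {w : E} (h : HasSum (fun i => ⟪f i, f i⟫_ℂ) ⟪w, w⟫_ℂ) :
    HasSum (fun i => ‖f i‖ ^ 2) (‖w‖ ^ 2) := by
  have h1 : ∀ x : H, (⟪x, x⟫_ℂ).re = ‖x‖ ^ 2 := inner_self_eq_norm_sq (𝕜 := ℂ)
  have h2 : (⟪w, w⟫_ℂ).re = ‖w‖ ^ 2 := inner_self_eq_norm_sq (𝕜 := ℂ) w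
  simpa only [h1, h2] using Complex.hasSum_re h

/-- A map of the form `a ↦ (a ⊗ 1) C` is ultraweakly continuous. -/
theorem continuous_ultraweak_of_amplification {J : Type*} {R : J → H →L[ℂ] E}
    (hR : ∀ u v : E, HasSum (fun i => ⟪ContinuousLinearMap.adjoint (R i) u,
      ContinuousLinearMap.adjoint (R i) v⟫_ℂ) ⟪u, v⟫_ℂ)
    {π : (H →L[ℂ] H) → (E →L[ℂ] E)} {C : E →L[ℂ] E}
    (hπ : ∀ i a v, ContinuousLinearMap.adjoint (R i) (π a v) =
      a (ContinuousLinearMap.adjoint (R i) (C v))) :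
    Continuous[ultraweak H, ultraweak E] π := by
  refine continuous_iInf_rng.2 ?_
  rintro ⟨⟨u, v⟩, hu, hv⟩
  rw [continuous_induced_rng]
  have hsq : ∀ w : E, HasSum (fun i => ‖ContinuousLinearMap.adjoint (R i) w‖ ^ 2) (‖w‖ ^ 2) :=
    fun w => hasSum_norm_sq_of_hasSum_inner (hR w w)
  have hprod : ∀ w : ℕ → E, (Summable fun n => ‖w n‖ ^ 2) →
      Summable fun p : ℕ × J => ‖ContinuousLinearMap.adjoint (R p.2) (w p.1)‖ ^ 2 := by
    intro w hw
    rw [summable_prod_of_nonneg fun p => by positivity]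
    refine ⟨fun n => (hsq (w n)).summable, ?_⟩
    simpa only [(hsq _).tsum_eq] using hw
  have hCv : Summable fun n => ‖C (v n)‖ ^ 2 := by
    refine Summable.of_nonneg_of_le (fun n => by positivity) (fun n => ?_) (hv.mul_left (‖C‖ ^ 2))
    rw [← mul_pow]
    gcongr
    exact C.le_opNorm _
  -- Since `∑ Rᵢ Rᵢ* = 1` weakly, each term expands over `J`; the doubly indexed families remain
  -- square-summable because `∑ᵢ ‖Rᵢ* w‖² = ‖w‖²`.
  have key : ∀ a : H →L[ℂ] H, ∑' n, ⟪u n, π a (v n)⟫_ℂ =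
      ∑' p : ℕ × J, ⟪ContinuousLinearMap.adjoint (R p.2) (u p.1),
        a (ContinuousLinearMap.adjoint (R p.2) (C (v p.1)))⟫_ℂ := by
    intro a
    rw [(summable_inner_apply (hprod u hu) (hprod (fun n => C (v n)) hCv) a).tsum_prod]
    refine tsum_congr fun n => ?_
    rw [← (hR (u n) (π a (v n))).tsum_eq]
    exact tsum_congr fun i => by rw [hπ]
  simp only [Function.comp_def, key]
  exact continuous_ultraweak_tsum (hprod u hu) (hprod (fun n => C (v n)) hCv)

theorem tendsto_apply_of_denseRange {V α : Type*} {l : Filter α} {f : V → E}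
    (hf : DenseRange f) {Q : α → E →L[ℂ] E} (hQ : ∀ a, ‖Q a‖ ≤ 1)
    (h : ∀ x, Tendsto (fun a => Q a (f x)) l (𝓝 (f x))) (v : E) :
    Tendsto (fun a => Q a v) l (𝓝 v) := by
  rw [Metric.tendsto_nhds]
  intro ε hε
  obtain ⟨x, hx⟩ := hf.exists_dist_lt v (by positivity : 0 < ε / 3)
  filter_upwards [Metric.tendsto_nhds.1 (h x) (ε / 3) (by positivity)] with a ha
  have h1 : dist (Q a v) (Q a (f x)) ≤ dist v (f x) := by
    rw [dist_eq_norm, dist_eq_norm, ← map_sub]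
    exact ((Q a).le_opNorm _).trans (mul_le_of_le_one_left (norm_nonneg _) (hQ a))
  have h2 := dist_triangle4 (Q a v) (Q a (f x)) (f x) v
  rw [dist_comm (f x) v] at h2
  linarith

end Amplification

/-! ### Restriction of normal functionals from `B(H ⊗ K)`. -/

section TensorNormal

variable {H K : Type*} [NormedAddCommGroup H] [InnerProductSpace ℂ H] [CompleteSpace H]
  [NormedAddCommGroup K] [InnerProductSpace ℂ K] [CompleteSpace K]

/-- The map `η ↦ ζ ⊗ η` from `K` to the Hilbert space tensor product. -/
def tensorLeft (ζ : H) : K →L[ℂ] HilbertTensor H K :=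
  UniformSpace.Completion.toComplL ∘SL TensorProduct.mkL ℂ H K ζ

theorem tensorLeft_apply (ζ : H) (η : K) :
    tensorLeft ζ η = ((ζ ⊗ₜ[ℂ] η : H ⊗[ℂ] K) : HilbertTensor H K) := rfl

theorem adjoint_tensorLeft_apply (ζ ξ : H) (η : K) :
    ContinuousLinearMap.adjoint (tensorLeft (K := K) ζ)
      ((ξ ⊗ₜ[ℂ] η : H ⊗[ℂ] K) : HilbertTensor H K) = ⟪ζ, ξ⟫_ℂ • η := by
  refine ext_inner_left ℂ fun u => ?_
  rw [ContinuousLinearMap.adjoint_inner_right, tensorLeft_apply,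
    UniformSpace.Completion.inner_coe, TensorProduct.inner_tmul, inner_smul_right]

theorem toOperator_rankOne_tmul (b : K →L[ℂ] K) (v w : H) :
    toOperator H K (tmul (rankOne ℂ v w) b) =
      tensorLeft v ∘SL b ∘SL ContinuousLinearMap.adjoint (tensorLeft w) := by
  refine ext_hilbertTensor fun ξ η => ?_
  simp only [toOperator_tmul, ContinuousLinearMap.comp_apply, adjoint_tensorLeft_apply, map_smul,
    tensorLeft_apply, rankOne_apply]
  rw [← TensorProduct.smul_tmul', UniformSpace.Completion.coe_smul]

theorem norm_toOperator_tmul_le (a : H →L[ℂ] H) (b : K →L[ℂ] K) :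
    ‖toOperator H K (tmul a b)‖ ≤ ‖a‖ * ‖b‖ := by
  refine ContinuousLinearMap.opNorm_le_bound _ (by positivity) fun x => ?_
  induction x using UniformSpace.Completion.induction_on with
  | hp => exact isClosed_le (by fun_prop) (by fun_prop)
  | ih x =>
    have h : toOperator H K (tmul a b) (x : HilbertTensor H K) =
        ((TensorProduct.mapL a b x : H ⊗[ℂ] K) : HilbertTensor H K) := by
      change (TensorProduct.mapL a b).completion _ = _
      simp
    rw [h, UniformSpace.Completion.norm_coe, UniformSpace.Completion.norm_coe]
    exact (TensorProduct.mapL a b).le_of_opNorm_le (TensorProduct.norm_mapL_le a b) x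

theorem tendsto_toOperator_of_tmul {α : Type*} {l : Filter α} {a : α → H →L[ℂ] H}
    {b : α → K →L[ℂ] K} (ha : ∀ n, ‖a n‖ ≤ 1) (hb : ∀ n, ‖b n‖ ≤ 1)
    (ha' : ∀ ξ, Tendsto (fun n => a n ξ) l (𝓝 ξ)) (hb' : ∀ η, Tendsto (fun n => b n η) l (𝓝 η))
    (v : HilbertTensor H K) :
    Tendsto (fun n => toOperator H K (tmul (a n) (b n)) v) l (𝓝 v) := by
  refine tendsto_apply_of_denseRange UniformSpace.Completion.denseRange_coe
    (fun n => (norm_toOperator_tmul_le _ _).trans (mul_le_one₀ (ha n) (norm_nonneg _) (hb n)))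
    (fun x => ?_) v
  induction x using TensorProduct.induction_on with
  | zero =>
    simp only [UniformSpace.Completion.coe_zero, map_zero]
    exact tendsto_const_nhds
  | tmul ξ η =>
    simp only [toOperator_tmul]
    refine (UniformSpace.Completion.continuous_coe _).tendsto _ |>.comp ?_
    exact (TensorProduct.continuous_tmul.tendsto (ξ, η)).comp ((ha' ξ).prodMk_nhds (hb' η))
  | add x y hx hy =>
    simp only [UniformSpace.Completion.coe_add, map_add]
    exact hx.add hy

/-- The partial sums of `∑ Rᵢ Rᵢ*`, with `Rᵢ = tensorRight (g i)`, are the operators `1 ⊗ P_F`,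
which converge strongly to `1`. -/
theorem hasSum_inner_adjoint_tensorRight {J : Type*} (g : HilbertBasis J ℂ K)
    (u v : HilbertTensor H K) :
    HasSum (fun i => ⟪ContinuousLinearMap.adjoint (tensorRight (H := H) (g i)) u,
      ContinuousLinearMap.adjoint (tensorRight (H := H) (g i)) v⟫_ℂ) ⟪u, v⟫_ℂ := by
  have h := tendsto_toOperator_of_tmul (a := fun _ : Finset J => (1 : H →L[ℂ] H))
    (b := fun F => orthoProj g F) (fun _ => ContinuousLinearMap.norm_id_le)
    (fun F => norm_orthoProj_le g.orthonormal F) (fun _ => tendsto_const_nhds)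
    (fun η => tendsto_orthoProj g η) v
  refine ((tendsto_const_nhds (x := u)).inner h).congr fun F => ?_
  simp only [orthoProj, ← tmulₗ_apply, map_sum]
  simp only [tmulₗ_apply, toOperator_tmul_rankOne, sum_apply, inner_sum,
    ContinuousLinearMap.adjoint_inner_left]
  rfl

theorem hasSum_inner_adjoint_tensorLeft {J : Type*} (g : HilbertBasis J ℂ H)
    (u v : HilbertTensor H K) :
    HasSum (fun i => ⟪ContinuousLinearMap.adjoint (tensorLeft (K := K) (g i)) u,
      ContinuousLinearMap.adjoint (tensorLeft (K := K) (g i)) v⟫_ℂ) ⟪u, v⟫_ℂ := by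
  have h := tendsto_toOperator_of_tmul (b := fun _ : Finset J => (1 : K →L[ℂ] K))
    (a := fun F => orthoProj g F) (fun F => norm_orthoProj_le g.orthonormal F)
    (fun _ => ContinuousLinearMap.norm_id_le) (fun η => tendsto_orthoProj g η)
    (fun _ => tendsto_const_nhds) v
  refine ((tendsto_const_nhds (x := u)).inner h).congr fun F => ?_
  have hs : tmul (orthoProj g F) (1 : K →L[ℂ] K) =
      ∑ i ∈ F, tmul (rankOne ℂ (g i) (g i)) 1 := TensorProduct.sum_tmul _ _ _
  simp only [hs, map_sum, toOperator_rankOne_tmul, sum_apply, inner_sum,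
    ContinuousLinearMap.adjoint_inner_left]
  rfl

theorem continuous_toOperator_left (b : K →L[ℂ] K) :
    Continuous[ultraweak H, ultraweak (HilbertTensor H K)]
      fun a => toOperator H K (tmul a b) := by
  obtain ⟨s, g, -⟩ := exists_hilbertBasis ℂ K
  refine continuous_ultraweak_of_amplification (hasSum_inner_adjoint_tensorRight g)
    (C := toOperator H K (tmul 1 b)) fun i a v => ?_
  have h : ContinuousLinearMap.adjoint (tensorRight (g i)) ∘SL toOperator H K (tmul a b) =
      a ∘SL ContinuousLinearMap.adjoint (tensorRight (g i)) ∘SL toOperator H K (tmul 1 b) :=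
    ext_hilbertTensor fun ξ η => by
      simp [toOperator_tmul, adjoint_tensorRight_apply]
  exact DFunLike.congr_fun h v

theorem continuous_toOperator_right (a : H →L[ℂ] H) :
    Continuous[ultraweak K, ultraweak (HilbertTensor H K)]
      fun b => toOperator H K (tmul a b) := by
  obtain ⟨s, g, -⟩ := exists_hilbertBasis ℂ H
  refine continuous_ultraweak_of_amplification (hasSum_inner_adjoint_tensorLeft g)
    (C := toOperator H K (tmul a 1)) fun i b v => ?_
  have h : ContinuousLinearMap.adjoint (tensorLeft (g i)) ∘SL toOperator H K (tmul a b) =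
      b ∘SL ContinuousLinearMap.adjoint (tensorLeft (g i)) ∘SL toOperator H K (tmul a 1) :=
    ext_hilbertTensor fun ξ η => by
      simp [toOperator_tmul, adjoint_tensorLeft_apply]
  exact DFunLike.congr_fun h v

/-- Normal functionals on `B(H ⊗ K)` restrict to normal functionals. -/
theorem exists_normalFunctional_of_predual (ω : Predual (HilbertTensor H K)) :
    ∃ Ψ : NormalFunctional H K, ∀ x : AlgTensor H K, (Ψ : ProjTensor H K →L[ℂ] ℂ) x =
      (ω : (HilbertTensor H K →L[ℂ] HilbertTensor H K) →L[ℂ] ℂ) (toOperator H K x) := by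
  set f := (ω : (HilbertTensor H K →L[ℂ] HilbertTensor H K) →L[ℂ] ℂ) with hf
  have hc : Continuous[ultraweak (HilbertTensor H K), inferInstance] fun x => f x :=
    continuous_of_mem_predual ω.2
  obtain ⟨Ψ, -, hΨ⟩ := exists_projTensor_functional
    (β := tmulₗ.compr₂ (f.toLinearMap ∘ₗ toOperator H K)) (norm_nonneg f) (fun a b => by
      refine (f.le_opNorm _).trans ?_
      gcongr
      exact norm_toOperator_tmul_le a b)
  have h : ∀ a b, Ψ (tmul a b : AlgTensor H K) = f (toOperator H K (tmul a b)) := fun a b => by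
    rw [hΨ, liftAlg_tmul]
    rfl
  refine ⟨⟨Ψ, fun b => ?_, fun a => ?_⟩, fun x => ?_⟩
  · simp only [h]
    let _ := ultraweak H
    let _ := ultraweak (HilbertTensor H K)
    exact hc.comp (continuous_toOperator_left b)
  · simp only [h]
    let _ := ultraweak K
    let _ := ultraweak (HilbertTensor H K)
    exact hc.comp (continuous_toOperator_right a)
  · change Ψ x = _
    induction x using algTensor_induction with
    | h0 => rw [UniformSpace.Completion.coe_zero, map_zero, map_zero, map_zero]
    | ht a b => exact h a b
    | hadd x y hx hy => rw [UniformSpace.Completion.coe_add, map_add, hx, hy, map_add, map_add]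

/-- Normal functionals that agree at tensor products of operators of rank one are equal. -/
theorem normalFunctional_ext {Φ Ψ : NormalFunctional H K}
    (h : ∀ (v w : H) (v' w' : K), (Φ : ProjTensor H K →L[ℂ] ℂ)
      (tmul (rankOne ℂ v w) (rankOne ℂ v' w') : AlgTensor H K) =
      (Ψ : ProjTensor H K →L[ℂ] ℂ) (tmul (rankOne ℂ v w) (rankOne ℂ v' w') : AlgTensor H K)) :
    Φ = Ψ := by
  set β : NormalFunctional H K → (H →L[ℂ] H) →ₗ[ℂ] (K →L[ℂ] K) →ₗ[ℂ] ℂ := fun Θ =>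
    tmulₗ.compr₂ ((Θ : ProjTensor H K →L[ℂ] ℂ) ∘SL ofAlg : AlgTensor H K →L[ℂ] ℂ).toLinearMap
  -- Agreement is extended one variable at a time: to all `a` with a rank one operator fixed in
  -- `B(K)`, and then to all `b`.
  have h1 : ∀ (v w : K) a, β Φ a (rankOne ℂ v w) = β Ψ a (rankOne ℂ v w) := fun v w a =>
    DFunLike.congr_fun (eq_of_forall_rankOne (f := (β Φ).flip (rankOne ℂ v w))
      (g := (β Ψ).flip (rankOne ℂ v w)) (Φ.2.1 _) (Ψ.2.1 _) fun v' w' => h v' w' v w) a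
  exact Subtype.ext <| ext_projTensor fun a b =>
    DFunLike.congr_fun (eq_of_forall_rankOne (f := β Φ a) (g := β Ψ a) (Φ.2.2 a) (Ψ.2.2 a)
      fun v w => h1 v w a) b

end TensorNormal

/-! ### Normal functionals from positive densities, and bounded extensions. -/

section Density

variable {H : Type*} [NormedAddCommGroup H] [InnerProductSpace ℂ H] [CompleteSpace H]

theorem exists_selfAdjoint_sqrt {T : H →L[ℂ] H} (hT : 0 ≤ T) :
    ∃ S : H →L[ℂ] H, ContinuousLinearMap.adjoint S = S ∧ T = S ∘SL S :=
  ⟨CFC.sqrt T, (CFC.sqrt_nonneg T).isSelfAdjoint, (CFC.sqrt_mul_sqrt_self T hT).symm⟩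

/-- A bounded functional with positive density agrees with a positive normal functional at the
operators of rank one. -/
theorem exists_normal_of_density_nonneg {f : (H →L[ℂ] H) →L[ℂ] ℂ} (hf : 0 ≤ density f) :
    ∃ ω : Predual H, (∀ y : H →L[ℂ] H, 0 ≤ y → 0 ≤ (ω : (H →L[ℂ] H) →L[ℂ] ℂ) y) ∧
      ∀ v w : H, (ω : (H →L[ℂ] H) →L[ℂ] ℂ) (rankOne ℂ v w) = f (rankOne ℂ v w) := by
  obtain ⟨S, hS, hfS⟩ := exists_selfAdjoint_sqrt hf
  have hSi : ∀ x y, ⟪S x, y⟫_ℂ = ⟪x, S y⟫_ℂ := fun x y => by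
    rw [← ContinuousLinearMap.adjoint_inner_left, hS]
  obtain ⟨s, g, -⟩ := exists_hilbertBasis ℂ H
  have hsum : Summable fun k => ‖S (g k)‖ ^ 2 := by
    refine summable_of_sum_le (c := ‖f‖) (fun k => by positivity) fun F => ?_
    have h1 : ∀ k, (‖S (g k)‖ ^ 2 : ℝ) = (f (rankOne ℂ (g k) (g k))).re := fun k => by
      rw [← inner_density, hfS, ContinuousLinearMap.comp_apply, ← hSi]
      exact (inner_self_eq_norm_sq (𝕜 := ℂ) _).symm
    have h2 : ∑ k ∈ F, ‖S (g k)‖ ^ 2 = (f (orthoProj g F)).re := by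
      simp only [h1, orthoProj, map_sum, Complex.re_sum]
    rw [h2]
    -- Boundedness of `f` alone gives the density finite trace; `f` is not assumed normal.
    calc (f (orthoProj g F)).re ≤ ‖f (orthoProj g F)‖ := Complex.re_le_norm _
      _ ≤ ‖f‖ * ‖orthoProj g F‖ := f.le_opNorm _
      _ ≤ ‖f‖ := mul_le_of_le_one_right (norm_nonneg _) (norm_orthoProj_le g.orthonormal F)
  obtain ⟨ω, hω⟩ := exists_predual_tsum hsum hsum
  refine ⟨ω, fun y hy => ?_, fun v w => ?_⟩
  · rw [hω]
    exact tsum_nonneg fun k => (nonneg_iff_inner_nonneg y).1 hy _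
  · rw [hω, ← inner_density, hfS, ContinuousLinearMap.comp_apply, ← hSi,
      -- Parseval for `⟨S w, S v⟩ = ⟨w, T v⟩`, where `T = S²` is the density.
      ← (g.hasSum_inner_mul_inner (S w) (S v)).tsum_eq]
    refine tsum_congr fun k => ?_
    rw [rankOne_apply, inner_smul_right, hSi, ← hSi w]

theorem norm_smul_one_sub_nonneg {T : H →L[ℂ] H} (hT : IsSelfAdjoint T) :
    0 ≤ (‖T‖ : ℂ) • 1 - T := by
  have h := hT.le_algebraMap_norm_self
  rwa [Algebra.algebraMap_eq_smul_one, ← Complex.coe_smul, ← sub_nonneg] at h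

theorem norm_smul_one_add_nonneg {T : H →L[ℂ] H} (hT : IsSelfAdjoint T) :
    0 ≤ (‖T‖ : ℂ) • 1 + T := by
  have h := hT.neg_algebraMap_norm_le_self
  rwa [Algebra.algebraMap_eq_smul_one, ← Complex.coe_smul, neg_le_iff_add_nonneg'] at h

theorem isSelfAdjoint_I_smul_sub_adjoint (X : H →L[ℂ] H) :
    IsSelfAdjoint (Complex.I • (X - ContinuousLinearMap.adjoint X)) := by
  rw [← ContinuousLinearMap.star_eq_adjoint, isSelfAdjoint_iff, star_smul, star_sub, star_star,
    Complex.star_def, Complex.conj_I, neg_smul, ← smul_neg, neg_sub]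

theorem norm_I_smul_sub_adjoint_le (X : H →L[ℂ] H) :
    ‖Complex.I • (X - ContinuousLinearMap.adjoint X)‖ ≤ 2 * ‖X‖ := by
  have hX : ‖ContinuousLinearMap.adjoint X‖ = ‖X‖ := LinearIsometryEquiv.norm_map _ _
  rw [norm_smul, Complex.norm_I, one_mul]
  linarith [norm_sub_le X (ContinuousLinearMap.adjoint X)]

theorem norm_add_adjoint_le (X : H →L[ℂ] H) :
    ‖X + ContinuousLinearMap.adjoint X‖ ≤ 2 * ‖X‖ := by
  have hX : ‖ContinuousLinearMap.adjoint X‖ = ‖X‖ := LinearIsometryEquiv.norm_map _ _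
  linarith [norm_add_le X (ContinuousLinearMap.adjoint X)]

/-- A functional dominated by the norm of `T x` is the composition of `T` with a bounded
functional. -/
theorem exists_continuousLinearMap_comp_eq {V : Type*} [AddCommGroup V] [Module ℂ V]
    (T : V →ₗ[ℂ] (H →L[ℂ] H)) (ω : V →ₗ[ℂ] ℂ) (C : ℝ) (h : ∀ x, ‖ω x‖ ≤ C * ‖T x‖) :
    ∃ f : (H →L[ℂ] H) →L[ℂ] ℂ, ∀ x, f (T x) = ω x := by
  obtain ⟨s, hs⟩ := LinearMap.exists_rightInverse_of_surjective T.rangeRestrict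
    (LinearMap.range_rangeRestrict _)
  have hs' : ∀ p : LinearMap.range T, T (s p) = p := fun p =>
    congrArg Subtype.val (DFunLike.congr_fun hs p)
  let f₀ : LinearMap.range T →L[ℂ] ℂ := (ω ∘ₗ s).mkContinuous C fun p => by
    have := h (s p)
    rwa [hs'] at this
  obtain ⟨f, hf, -⟩ := exists_extension_norm_eq _ f₀
  refine ⟨f, fun x => ?_⟩
  refine (hf ⟨T x, LinearMap.mem_range_self _ x⟩).trans ?_
  change ω (s _) = ω x
  -- The bound `h` makes `ω` vanish on the kernel of `T`, so the choice of the linear section `s`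
  -- does not matter.
  rw [← sub_eq_zero, ← map_sub, ← norm_le_zero_iff]
  have := h (s ⟨T x, LinearMap.mem_range_self _ x⟩ - x)
  rwa [map_sub T, hs', sub_self, norm_zero, mul_zero] at this

end Density

/-! ### Positive functionals on the injective cone and the three equivalences. -/

section Positive

variable {H K : Type*} [NormedAddCommGroup H] [InnerProductSpace ℂ H] [CompleteSpace H]
  [NormedAddCommGroup K] [InnerProductSpace ℂ K] [CompleteSpace K]

theorem toOperator_tmul_one_one : toOperator H K (tmul 1 1) = 1 :=
  ext_hilbertTensor fun ξ η => by simp [toOperator_tmul]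

theorem adjoint_toOperator_tmul (a : H →L[ℂ] H) (b : K →L[ℂ] K) :
    ContinuousLinearMap.adjoint (toOperator H K (tmul a b)) =
      toOperator H K (tmul (ContinuousLinearMap.adjoint a) (ContinuousLinearMap.adjoint b)) := by
  refine ext_hilbertTensor fun ξ η => ext_inner_right ℂ fun w => ?_
  rw [ContinuousLinearMap.adjoint_inner_left, toOperator_tmul]
  refine DFunLike.congr_fun (f := innerSL ℂ ((ξ ⊗ₜ[ℂ] η : H ⊗[ℂ] K) : HilbertTensor H K) ∘SL
    toOperator H K (tmul a b)) (g := innerSL ℂ (((ContinuousLinearMap.adjoint a ξ) ⊗ₜ[ℂ]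
      (ContinuousLinearMap.adjoint b η) : H ⊗[ℂ] K) : HilbertTensor H K)) ?_ w
  refine ext_hilbertTensor fun ξ' η' => ?_
  rw [ContinuousLinearMap.comp_apply, toOperator_tmul, innerSL_apply_apply, innerSL_apply_apply,
    UniformSpace.Completion.inner_coe, UniformSpace.Completion.inner_coe,
    TensorProduct.inner_tmul, TensorProduct.inner_tmul, ContinuousLinearMap.adjoint_inner_left,
    ContinuousLinearMap.adjoint_inner_left]

theorem exists_toOperator_eq_adjoint (x : AlgTensor H K) :
    ∃ y, toOperator H K y = ContinuousLinearMap.adjoint (toOperator H K x) := by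
  induction x using algTensor_induction with
  | h0 => exact ⟨0, by simp⟩
  | ht a b => exact ⟨_, (adjoint_toOperator_tmul a b).symm⟩
  | hadd x y hx hy =>
    obtain ⟨x', hx⟩ := hx
    obtain ⟨y', hy⟩ := hy
    exact ⟨x' + y', by rw [map_add, map_add, map_add, hx, hy]⟩

theorem rankOne_tmul_tmul (ξ ξ' : H) (η η' : K) :
    rankOne ℂ ((ξ ⊗ₜ[ℂ] η : H ⊗[ℂ] K) : HilbertTensor H K)
      ((ξ' ⊗ₜ[ℂ] η' : H ⊗[ℂ] K) : HilbertTensor H K) =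
      toOperator H K (tmul (rankOne ℂ ξ ξ') (rankOne ℂ η η')) := by
  refine ext_hilbertTensor fun u v => ?_
  rw [toOperator_tmul, rankOne_apply, rankOne_apply, rankOne_apply,
    UniformSpace.Completion.inner_coe, TensorProduct.inner_tmul, TensorProduct.tmul_smul,
    ← TensorProduct.smul_tmul', smul_smul, UniformSpace.Completion.coe_smul, mul_comm]

theorem exists_toOperator_eq_rankOne (z w : H ⊗[ℂ] K) :
    ∃ x, toOperator H K x = rankOne ℂ (z : HilbertTensor H K) (w : HilbertTensor H K) := by
  induction z using TensorProduct.induction_on with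
  | zero => exact ⟨0, by simp only [UniformSpace.Completion.coe_zero, map_zero]; rfl⟩
  | add z z' hz hz' =>
    obtain ⟨x, hx⟩ := hz
    obtain ⟨y, hy⟩ := hz'
    exact ⟨x + y, by rw [map_add, UniformSpace.Completion.coe_add, map_add, add_apply, hx, hy]⟩
  | tmul ξ η =>
    induction w using TensorProduct.induction_on with
    | zero => exact ⟨0, by simp only [UniformSpace.Completion.coe_zero, map_zero]⟩
    | add z z' hz hz' =>
      obtain ⟨x, hx⟩ := hz
      obtain ⟨y, hy⟩ := hz'
      exact ⟨x + y, by rw [map_add, UniformSpace.Completion.coe_add, map_add, hx, hy]⟩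
    | tmul ξ' η' => exact ⟨_, (rankOne_tmul_tmul ξ ξ' η η').symm⟩

theorem rankOne_self_nonneg (z : H) : 0 ≤ rankOne ℂ z z := by
  rw [nonneg_iff_inner_nonneg]
  intro x
  rw [rankOne_apply, inner_smul_right, ← inner_conj_symm x z]
  exact mul_star_self_nonneg _

variable {ω : AlgTensor H K →ₗ[ℂ] ℂ}

/-- The usual order unit estimate: `ω` is nonnegative at `‖X‖ 1 ± x`, where `X` is the operator of
`x`, which makes `ω x` real and bounds it on both sides. -/
theorem norm_apply_le_of_isSelfAdjoint (hω : ∀ x, 0 ≤ toOperator H K x → 0 ≤ ω x)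
    {x : AlgTensor H K} (hx : IsSelfAdjoint (toOperator H K x)) :
    ‖ω x‖ ≤ ‖ω (tmul 1 1)‖ * ‖toOperator H K x‖ := by
  set c : ℝ := ‖toOperator H K x‖ with hc
  have h1 := hω ((c : ℂ) • tmul 1 1 - x) (by
    rw [map_sub, map_smul, toOperator_tmul_one_one]
    exact norm_smul_one_sub_nonneg hx)
  have h2 := hω ((c : ℂ) • tmul 1 1 + x) (by
    rw [map_add, map_smul, toOperator_tmul_one_one]
    exact norm_smul_one_add_nonneg hx)
  rw [map_sub, map_smul, Complex.nonneg_iff] at h1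
  rw [map_add, map_smul, Complex.nonneg_iff] at h2
  simp only [smul_eq_mul, Complex.sub_re, Complex.add_re, Complex.sub_im, Complex.add_im,
    Complex.re_ofReal_mul, Complex.im_ofReal_mul] at h1 h2
  have him : (ω x).im = 0 := by linarith [h1.2, h2.2]
  have hre : ‖ω x‖ = |(ω x).re| := by
    rw [← Complex.abs_re_eq_norm.2 him]
  have hle : c * (ω (tmul 1 1)).re ≤ ‖ω (tmul 1 1)‖ * c := by
    rw [mul_comm]
    gcongr
    exact Complex.re_le_norm _
  rw [hre, abs_le]
  constructor <;> linarith [h1.1, h2.1]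

/-- Write `2x = (x + y) + (x - y)`, where `y` represents the adjoint: `x + y` and `i(x - y)` are
self-adjoint with norm at most `2‖X‖`. The factor `2` is harmless, as only boundedness is needed. -/
theorem norm_apply_le_of_nonneg (hω : ∀ x, 0 ≤ toOperator H K x → 0 ≤ ω x)
    (x : AlgTensor H K) : ‖ω x‖ ≤ 2 * ‖ω (tmul 1 1)‖ * ‖toOperator H K x‖ := by
  obtain ⟨y, hy⟩ := exists_toOperator_eq_adjoint x
  set X := toOperator H K x with hX
  have hadd : toOperator H K (x + y) = X + ContinuousLinearMap.adjoint X := by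
    rw [map_add, hy]
  have hsub : toOperator H K (Complex.I • (x - y)) =
      Complex.I • (X - ContinuousLinearMap.adjoint X) := by
    rw [map_smul, map_sub, hy]
  have h3 := norm_apply_le_of_isSelfAdjoint hω (x := x + y)
    (by rw [hadd]; exact IsSelfAdjoint.add_star_self X)
  have h4 := norm_apply_le_of_isSelfAdjoint hω (x := Complex.I • (x - y))
    (by rw [hsub]; exact isSelfAdjoint_I_smul_sub_adjoint X)
  have h5 : ‖toOperator H K (x + y)‖ ≤ 2 * ‖X‖ := by
    rw [hadd]
    exact norm_add_adjoint_le X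
  have h6 : ‖toOperator H K (Complex.I • (x - y))‖ ≤ 2 * ‖X‖ := by
    rw [hsub]
    exact norm_I_smul_sub_adjoint_le X
  rw [map_smul, norm_smul, Complex.norm_I, one_mul] at h4
  have h7 : (2 : ℂ) * ω x = ω (x + y) + ω (x - y) := by
    rw [map_add, map_sub]
    ring
  have h8 : 2 * ‖ω x‖ ≤ ‖ω (x + y)‖ + ‖ω (x - y)‖ := by
    have := norm_add_le (ω (x + y)) (ω (x - y))
    rwa [← h7, norm_mul, Complex.norm_ofNat] at this
  have h9 := mul_le_mul_of_nonneg_left h5 (norm_nonneg (ω (tmul 1 1)))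
  have h10 := mul_le_mul_of_nonneg_left h6 (norm_nonneg (ω (tmul 1 1)))
  linarith

/-- A functional that is positive on the injective cone extends to a bounded functional on
`B(H ⊗ K)`. -/
theorem exists_extension_of_nonneg (hω : ∀ x, 0 ≤ toOperator H K x → 0 ≤ ω x) :
    ∃ f : (HilbertTensor H K →L[ℂ] HilbertTensor H K) →L[ℂ] ℂ,
      ∀ x, f (toOperator H K x) = ω x :=
  exists_continuousLinearMap_comp_eq (toOperator H K) ω _
    (norm_apply_le_of_nonneg hω)

/-- The extension `f` need not be positive, but the operators `|z⟩⟨z|` with `z` in the algebraic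
tensor product lie in the image of `B(H) ⊙ B(K)`, where `f` is `ω`. Such `z` are dense. -/
theorem density_nonneg_of_extension (hω : ∀ x, 0 ≤ toOperator H K x → 0 ≤ ω x)
    {f : (HilbertTensor H K →L[ℂ] HilbertTensor H K) →L[ℂ] ℂ}
    (hf : ∀ x, f (toOperator H K x) = ω x) : 0 ≤ density f := by
  rw [nonneg_iff_inner_nonneg]
  intro z
  induction z using UniformSpace.Completion.induction_on with
  | hp => exact isClosed_le (by fun_prop) (by fun_prop)
  | ih z =>
    obtain ⟨x, hx⟩ := exists_toOperator_eq_rankOne z z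
    rw [inner_density, ← hx, hf]
    exact hω x (hx ▸ rankOne_self_nonneg _)

/-- Normal functionals that are positive on the injective cone are restrictions of positive normal
functionals on `B(H ⊗ K)`. -/
theorem exists_positive_predual (Ψ : NormalFunctional H K)
    (h : PositiveOnInjectiveCone (Ψ : ProjTensor H K →L[ℂ] ℂ)) :
    ∃ ω : Predual (HilbertTensor H K),
      (∀ y : HilbertTensor H K →L[ℂ] HilbertTensor H K, 0 ≤ y →
        0 ≤ (ω : (HilbertTensor H K →L[ℂ] HilbertTensor H K) →L[ℂ] ℂ) y) ∧
      ∀ x : AlgTensor H K, (Ψ : ProjTensor H K →L[ℂ] ℂ) x =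
        (ω : (HilbertTensor H K →L[ℂ] HilbertTensor H K) →L[ℂ] ℂ) (toOperator H K x) := by
  let ψ : AlgTensor H K →ₗ[ℂ] ℂ :=
    ((Ψ : ProjTensor H K →L[ℂ] ℂ) ∘SL ofAlg : AlgTensor H K →L[ℂ] ℂ).toLinearMap
  obtain ⟨f, hf⟩ := exists_extension_of_nonneg (ω := ψ) h
  obtain ⟨ω, hω, hωf⟩ := exists_normal_of_density_nonneg (density_nonneg_of_extension (ω := ψ) h hf)
  obtain ⟨Φ, hΦ⟩ := exists_normalFunctional_of_predual ω
  have hΨΦ : Ψ = Φ := normalFunctional_ext fun v w v' w' => by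
    rw [hΦ, ← rankOne_tmul_tmul, hωf, rankOne_tmul_tmul, hf]
    rfl
  exact ⟨ω, hω, fun x => by rw [hΨΦ, hΦ]⟩

variable {ι : Type*} (e : HilbertBasis ι ℂ K)

theorem exists_equiv_completelyPositive :
    ∃ Ψ : NormalMap H K ≃ₗᵢ[ℂ] NormalFunctional H K,
      (∀ (ψ : NormalMap H K) (n : ℕ) (a : Fin n → H →L[ℂ] H) (b : Fin n → K →L[ℂ] K),
        HasTrace (∑ i, traceClassMap ψ (a i) ∘SL transpose e (b i))
          ((Ψ ψ : ProjTensor H K →L[ℂ] ℂ) (∑ i, tmul (a i) (b i) : AlgTensor H K))) ∧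
      ∀ ψ : NormalMap H K,
        PositiveOnInjectiveCone (Ψ ψ : ProjTensor H K →L[ℂ] ℂ) ↔
          IsCompletelyPositive (traceClassMap ψ) := by
  obtain ⟨Ψ, hΨ⟩ := exists_normalMap_equiv (H := H) (transposeₗᵢ e) (continuous_transpose e)
    (continuous_transpose e)
  refine ⟨Ψ, fun ψ n a b => ?_, fun ψ => ?_⟩
  · exact hasTrace_traceClassMap_sum (transposeₗᵢ e) (hΨ ψ) a b
  · exact positiveOnInjectiveCone_iff_isCompletelyPositive e (hΨ ψ)

theorem exists_equiv_completelyCopositive :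
    ∃ Φ : NormalMap H K ≃ₗᵢ[ℂ] NormalFunctional H K,
      (∀ (φ : NormalMap H K) (n : ℕ) (a : Fin n → H →L[ℂ] H) (b : Fin n → K →L[ℂ] K),
        HasTrace (∑ i, traceClassMap φ (a i) ∘SL b i)
          ((Φ φ : ProjTensor H K →L[ℂ] ℂ) (∑ i, tmul (a i) (b i) : AlgTensor H K))) ∧
      ∀ φ : NormalMap H K,
        PositiveOnInjectiveCone (Φ φ : ProjTensor H K →L[ℂ] ℂ) ↔
          IsCompletelyCopositive e (traceClassMap φ) := by
  obtain ⟨Φ, hΦ⟩ := exists_normalMap_equiv (H := H) (LinearIsometryEquiv.refl ℂ (K →L[ℂ] K))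
    (@continuous_id _ (ultraweak K)) (@continuous_id _ (ultraweak K))
  refine ⟨Φ, fun φ n a b => ?_, fun φ => ?_⟩
  · exact hasTrace_traceClassMap_sum (LinearIsometryEquiv.refl ℂ _) (hΦ φ) a b
  · exact positiveOnInjectiveCone_iff_isCompletelyCopositive e (hΦ φ)

end Positive

end EntanglementMaps

end

open EntanglementMaps in
theorem mainTheorem4 {H K : Type*}
    [NormedAddCommGroup H] [InnerProductSpace ℂ H] [CompleteSpace H]
    [NormedAddCommGroup K] [InnerProductSpace ℂ K] [CompleteSpace K]
    {ι : Type*} (e : HilbertBasis ι ℂ K) :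
    (∃ Ψ : NormalMap H K ≃ₗᵢ[ℂ] NormalFunctional H K,
      (∀ (ψ : NormalMap H K) (n : ℕ) (a : Fin n → H →L[ℂ] H) (b : Fin n → K →L[ℂ] K),
        HasTrace (∑ i, traceClassMap ψ (a i) ∘SL transpose e (b i))
          ((Ψ ψ : ProjTensor H K →L[ℂ] ℂ) (∑ i, tmul (a i) (b i) : AlgTensor H K))) ∧
      ∀ ψ : NormalMap H K,
        PositiveOnInjectiveCone (Ψ ψ : ProjTensor H K →L[ℂ] ℂ) ↔
          IsCompletelyPositive (traceClassMap ψ)) ∧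
    (∃ Φ : NormalMap H K ≃ₗᵢ[ℂ] NormalFunctional H K,
      (∀ (φ : NormalMap H K) (n : ℕ) (a : Fin n → H →L[ℂ] H) (b : Fin n → K →L[ℂ] K),
        HasTrace (∑ i, traceClassMap φ (a i) ∘SL b i)
          ((Φ φ : ProjTensor H K →L[ℂ] ℂ) (∑ i, tmul (a i) (b i) : AlgTensor H K))) ∧
      ∀ φ : NormalMap H K,
        PositiveOnInjectiveCone (Φ φ : ProjTensor H K →L[ℂ] ℂ) ↔
          IsCompletelyCopositive e (traceClassMap φ)) ∧
    (∀ ω : Predual (HilbertTensor H K),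
      ∃ Ψ : NormalFunctional H K, ∀ x : AlgTensor H K,
        (Ψ : ProjTensor H K →L[ℂ] ℂ) x =
          (ω : (HilbertTensor H K →L[ℂ] HilbertTensor H K) →L[ℂ] ℂ) (toOperator H K x)) ∧
    (∀ Ψ : NormalFunctional H K,
      PositiveOnInjectiveCone (Ψ : ProjTensor H K →L[ℂ] ℂ) ↔
        ∃ ω : Predual (HilbertTensor H K),
          (∀ y : HilbertTensor H K →L[ℂ] HilbertTensor H K, 0 ≤ y →
            0 ≤ (ω : (HilbertTensor H K →L[ℂ] HilbertTensor H K) →L[ℂ] ℂ) y) ∧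
          ∀ x : AlgTensor H K, (Ψ : ProjTensor H K →L[ℂ] ℂ) x =
            (ω : (HilbertTensor H K →L[ℂ] HilbertTensor H K) →L[ℂ] ℂ) (toOperator H K x)) := by
  refine ⟨exists_equiv_completelyPositive e, exists_equiv_completelyCopositive e,
    exists_normalFunctional_of_predual, fun Ψ =>
    ⟨exists_positive_predual Ψ, ?_⟩⟩
  · rintro ⟨ω, hω, h⟩ x hx
    rw [h]
    exact hω _ hx
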